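/- We work over $\mathbb{C}$. Let $\mathcal{O}(a,b)=\mathcal{O}_{\mathbb{P}^1}(a)\boxtimes\mathcal{O}_{\mathbb{P}^2}(b)$ on $\mathbb{P}^1\times\mathbb{P}^2$. A rational curve of bidegree $(5,2)$ in $\mathbb{P}^1\times\mathbb{P}^2$ is the image $C$ of a morphism $\mathbb{P}^1\to\mathbb{P}^1\times\mathbb{P}^2$, $t\mapsto((f_0(t):f_1(t)),(g_0(t):g_1(t):g_2(t)))$, where $f_0,f_1$ are binary forms of degree $5$ without common zeros and $g_0,g_1,g_2$ are binary forms of degree $2$ without common zeros (such a morphism is automatically birational onto its image, since $5$ and $2$ are coprime); $C$ carries its reduced structure and $\mathcal{I}_C$ is its ideal sheaf. The tuples $(f,g)$ form a nonempty Zariski open subset $\mathcal{R}$ of the affine space of all tuples of forms. Let $\mathcal{M}$ be the affine space of all $3\times 2$ matrices of bihomogeneous forms defining morphisms $$\mathcal{O}(-1,-4)^{\oplus 2}\longrightarrow\mathcal{O}(0,-2)\oplus\mathcal{O}(-1,-3)^{\oplus 2},$$ that is, the entries of the first row have bidegree $(1,2)$ and the entries of the other two rows have bidegree $(0,1)$.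 (1) There is a nonempty Zariski open subset of $\mathcal{R}$ such that for every curve $C$ in it there are a matrix $M\in\mathcal{M}$ and a short exact sequence of sheaves of $\mathcal{O}$-modules $$0\longrightarrow\mathcal{O}(-1,-4)^{\oplus 2}\xrightarrow{\;M\;}\mathcal{O}(0,-2)\oplus\mathcal{O}(-1,-3)^{\oplus 2}\longrightarrow\mathcal{I}_C\longrightarrow 0.\qquad(*)$$ (2) Conversely, a general matrix presents the ideal sheaf of a general curve: for every nonempty Zariski open subset $U\subseteq\mathcal{R}$ there is a nonempty Zariski open subset $W\subseteq\mathcal{M}$ such that for every $M\in W$ there are a curve $C$ in $U$ and a short exact sequence $(*)$ whose first morphism is given by $M$. -/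

import Mathlib

open CategoryTheory TopologicalSpace Opposite

open scoped Topology

noncomputable section

namespace ProjLinePlane

/-! ### The variety `ℙ¹ × ℙ²` over `ℂ` and its Cox ring -/

/-- The closed points of `ℙ¹ × ℙ²` over `ℂ`. -/
@[ext]
structure Pt where
  /-- the component in the projective line -/
  fst : Projectivization ℂ (Fin 2 → ℂ)
  /-- the component in the projective plane -/
  snd : Projectivization ℂ (Fin 3 → ℂ)

/-- Homogeneous coordinates of points of `ℙ¹ × ℙ²`: a nonzero vector of `ℂ²` and a nonzero
vector of `ℂ³`. -/
abbrev Coord : Type := {v : Fin 2 → ℂ // v ≠ 0} × {w : Fin 3 → ℂ // w ≠ 0}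

/-- The point with the given homogeneous coordinates. -/
def proj (y : Coord) : Pt :=
  ⟨Projectivization.mk ℂ y.1.1 y.1.2, Projectivization.mk ℂ y.2.1 y.2.2⟩

/-- The Cox ring `ℂ[s₀, s₁, x₀, x₁, x₂]` of `ℙ¹ × ℙ²`. -/
abbrev Cox : Type := MvPolynomial (Fin 2 ⊕ Fin 3) ℂ

/-- The bigrading: the `sᵢ` have bidegree `(1, 0)`, the `xⱼ` have bidegree `(0, 1)`. -/
def bideg : Fin 2 ⊕ Fin 3 → ℤ × ℤ := Sum.elim (fun _ => (1, 0)) (fun _ => (0, 1))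

/-- The space of bihomogeneous forms of bidegree `d` (it is zero if an entry of `d` is negative). -/
abbrev Forms (d : ℤ × ℤ) : Submodule ℂ Cox :=
  MvPolynomial.weightedHomogeneousSubmodule ℂ bideg d

/-- The value of a polynomial at homogeneous coordinates. -/
def val (F : Cox) (y : Coord) : ℂ := MvPolynomial.eval (Sum.elim y.1.1 y.2.1) F

/-- The Zariski topology of `ℙ¹ × ℙ²`: a basis of open sets is given by the loci where a
bihomogeneous form does not vanish. -/
instance : TopologicalSpace Pt :=
  generateFrom {U | ∃ (d : ℤ × ℤ) (G : Forms d), U = {p | ∀ y, proj y = p → val G y ≠ 0}}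

/-- `ℙ¹ × ℙ²` with its Zariski topology. -/
abbrev X : TopCat.{0} := TopCat.of Pt

/-- The homogeneous coordinates of the points of an open set. -/
abbrev Over (U : Opens X) : Type := {y : Coord // proj y ∈ U}

/-- Restriction of functions. -/
def res {W : Type} {U V : Opens X} (h : V ≤ U) (σ : Over U → W) : Over V → W :=
  fun y => σ ⟨y.1, h y.2⟩

/-! ### The structure sheaf, the sheaves `𝒪(a, b)` and ideal sheaves -/

/-- A function of the homogeneous coordinates of the points of `U` is a section of `𝒪(d)` over `U`
if, locally on `U`, it is a fraction `F / G` of bihomogeneous forms whose bidegrees differ by `d`,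
with `G` nowhere zero. -/
def IsSection (d : ℤ × ℤ) {U : Opens X} (σ : Over U → ℂ) : Prop :=
  ∀ p ∈ U, ∃ (V : Opens X) (h : V ≤ U) (e : ℤ × ℤ) (F : Forms (e + d)) (G : Forms e), p ∈ V ∧
    ∀ y : Over V, val G y.1 ≠ 0 ∧ res h σ y = val F y.1 / val G y.1

section basic

variable {d e : ℤ × ℤ} {U V : Opens X}

lemma val_add (F G : Cox) (y : Coord) : val (F + G) y = val F y + val G y := by simp [val]

lemma val_mul (F G : Cox) (y : Coord) : val (F * G) y = val F y * val G y := by simp [val]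

lemma val_neg (F : Cox) (y : Coord) : val (-F) y = -val F y := by simp [val]

lemma mul_mem {F G : Cox} (hF : F ∈ Forms d) (hG : G ∈ Forms e) : F * G ∈ Forms (d + e) :=
  MvPolynomial.IsWeightedHomogeneous.mul hF hG

lemma IsSection.of_form (F : Forms d) : IsSection d (U := U) (fun y => val F y.1) := fun p hp =>
  ⟨U, le_rfl, 0, ⟨F, by simp⟩,
    ⟨1, MvPolynomial.isWeightedHomogeneous_one ℂ bideg⟩, hp,
    fun y => ⟨by simp [val], by simp [val, res]⟩⟩

lemma IsSection.zero : IsSection d (0 : Over U → ℂ) := fun p hp =>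
  ⟨U, le_rfl, 0, ⟨0, zero_mem _⟩, ⟨1, MvPolynomial.isWeightedHomogeneous_one ℂ bideg⟩, hp,
    fun y => ⟨by simp [val], by simp [val, res]⟩⟩

lemma IsSection.one : IsSection 0 (1 : Over U → ℂ) := fun p hp =>
  ⟨U, le_rfl, 0, ⟨1, MvPolynomial.isWeightedHomogeneous_one ℂ bideg⟩,
    ⟨1, MvPolynomial.isWeightedHomogeneous_one ℂ bideg⟩, hp,
    fun y => ⟨by simp [val], by simp [val, res]⟩⟩

lemma IsSection.neg {σ : Over U → ℂ} (hσ : IsSection d σ) : IsSection d (-σ) := fun p hp => by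
  obtain ⟨V, h, e, F, G, hpV, H⟩ := hσ p hp
  refine ⟨V, h, e, -F, G, hpV, fun y => ⟨(H y).1, ?_⟩⟩
  have := (H y).2
  simp only [res] at this
  simp [res, this, val_neg, neg_div]

lemma IsSection.add {σ τ : Over U → ℂ} (hσ : IsSection d σ) (hτ : IsSection d τ) :
    IsSection d (σ + τ) := fun p hp => by
  obtain ⟨V, h, e, F, G, hpV, H⟩ := hσ p hp
  obtain ⟨V', h', e', F', G', hpV', H'⟩ := hτ p hp
  refine ⟨V ⊓ V', inf_le_left.trans h, e + e', ⟨F * G' + F' * G, add_mem ?_ ?_⟩,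
    ⟨G * G', mul_mem G.2 G'.2⟩, ⟨hpV, hpV'⟩, fun y => ?_⟩
  · have := mul_mem F.2 G'.2
    rwa [add_right_comm] at this
  · have := mul_mem F'.2 G.2
    rwa [show e' + d + e = e + e' + d by abel] at this
  · obtain ⟨h1, h2⟩ := H ⟨y.1, y.2.1⟩
    obtain ⟨h3, h4⟩ := H' ⟨y.1, y.2.2⟩
    simp only [res] at h1 h2 h3 h4 ⊢
    refine ⟨by rw [val_mul]; exact mul_ne_zero h1 h3, ?_⟩
    rw [Pi.add_apply, h2, h4, val_mul, val_add, val_mul, val_mul, div_add_div _ _ h1 h3]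
    ring

lemma IsSection.mul {σ τ : Over U → ℂ} (hσ : IsSection d σ) (hτ : IsSection e τ) :
    IsSection (d + e) (σ * τ) := fun p hp => by
  obtain ⟨V, h, a, F, G, hpV, H⟩ := hσ p hp
  obtain ⟨V', h', a', F', G', hpV', H'⟩ := hτ p hp
  refine ⟨V ⊓ V', inf_le_left.trans h, a + a', ⟨F * F', ?_⟩,
    ⟨G * G', mul_mem G.2 G'.2⟩, ⟨hpV, hpV'⟩, fun y => ?_⟩
  · have := mul_mem F.2 F'.2
    rwa [show a + d + (a' + e) = a + a' + (d + e) by abel] at this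
  · obtain ⟨h1, h2⟩ := H ⟨y.1, y.2.1⟩
    obtain ⟨h3, h4⟩ := H' ⟨y.1, y.2.2⟩
    simp only [res] at h1 h2 h3 h4 ⊢
    refine ⟨by rw [val_mul]; exact mul_ne_zero h1 h3, ?_⟩
    rw [Pi.mul_apply, h2, h4, val_mul, val_mul, div_mul_div_comm]

lemma IsSection.res {σ : Over U → ℂ} (hσ : IsSection d σ) (h : V ≤ U) :
    IsSection d (res h σ) := fun p hp => by
  obtain ⟨V', h', e, F, G, hpV, H⟩ := hσ p (h hp)
  exact ⟨V' ⊓ V, inf_le_right, e, F, G, ⟨hpV, hp⟩, fun y => H ⟨y.1, y.2.1⟩⟩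

lemma IsSection.of_local {σ : Over U → ℂ}
    (hσ : ∀ p ∈ U, ∃ (V : Opens X) (h : V ≤ U), p ∈ V ∧ IsSection d (ProjLinePlane.res h σ)) :
    IsSection d σ := fun p hp => by
  obtain ⟨V, h, hpV, H⟩ := hσ p hp
  obtain ⟨V', h', e, F, G, hpV', H'⟩ := H p hpV
  exact ⟨V', h'.trans h, e, F, G, hpV', H'⟩

end basic

/-- The ring `𝒪(U)` of regular functions on the open set `U`. -/
def regular (U : Opens X) : Subring (Over U → ℂ) where
  carrier := {σ | IsSection 0 σ}
  zero_mem' := IsSection.zero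
  one_mem' := IsSection.one
  add_mem' := IsSection.add
  neg_mem' := IsSection.neg
  mul_mem' h h' := by simpa using IsSection.mul h h'

/-- A sheaf of `𝒪`-modules that consists of functions of the homogeneous coordinates with values
in the vector space `W`: modules of functions which are stable under restriction, such that
membership is a local condition. -/
structure FunctionModule (W : Type) [AddCommGroup W] [Module ℂ W] where
  /-- the sections over an open set -/
  sec (U : Opens X) : Submodule (regular U) (Over U → W)
  res_mem {U V : Opens X} (h : V ≤ U) (σ : Over U → W) : σ ∈ sec U → res h σ ∈ sec V
  of_local {U : Opens X} (σ : Over U → W) :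
    (∀ p ∈ U, ∃ (V : Opens X) (h : V ≤ U), p ∈ V ∧ res h σ ∈ sec V) → σ ∈ sec U

/-- The structure sheaf as a presheaf of rings. -/
def structurePresheaf : (Opens X)ᵒᵖ ⥤ RingCat.{0} where
  obj U := RingCat.of (regular U.unop)
  map {U V} i := RingCat.ofHom
    { toFun := fun σ => ⟨res i.unop.le σ.1, σ.2.res i.unop.le⟩
      map_zero' := rfl
      map_one' := rfl
      map_add' := fun _ _ => rfl
      map_mul' := fun _ _ => rfl }

/-- Functions that are given on the members of an open covering and agree on overlaps glue. -/
lemma exists_glue {W : Type} {ι : Type} (U : ι → Opens X) (sf : ∀ i, Over (U i) → W)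
    (hsf : ∀ i j (y : Coord) (hi : proj y ∈ U i) (hj : proj y ∈ U j),
      sf i ⟨y, hi⟩ = sf j ⟨y, hj⟩) :
    ∃ σ : Over (iSup U) → W, ∀ i, res (le_iSup U i) σ = sf i := by
  have hm : ∀ y : Over (iSup U), ∃ i, proj y.1 ∈ U i := fun y => by simpa using y.2
  choose c hc using hm
  exact ⟨fun y => sf (c y) ⟨y.1, hc y⟩, fun i => funext fun y => hsf _ _ _ _ _⟩

lemma isSheaf_structurePresheaf :
    Presheaf.IsSheaf (Opens.grothendieckTopology X) structurePresheaf := by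
  refine (TopCat.Presheaf.isSheaf_iff_isSheaf_comp (forget RingCat) structurePresheaf).2 ?_
  refine TopCat.Presheaf.isSheaf_of_isSheafUniqueGluing_types _ ?_
  intro ι U sf hsf
  obtain ⟨σ, hσ⟩ := exists_glue U (fun i => (sf i : regular (U i)).1) (fun i j y hi hj =>
    congrFun (congrArg Subtype.val (hsf i j)) ⟨y, hi, hj⟩)
  refine ⟨(⟨σ, ?_⟩ : regular (iSup U)), fun i => Subtype.ext (hσ i), fun τ hτ => ?_⟩
  · refine IsSection.of_local fun p hp => ?_
    obtain ⟨i, hi⟩ := Opens.mem_iSup.1 hp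
    exact ⟨U i, le_iSup U i, hi, by rw [hσ]; exact (sf i : regular (U i)).2⟩
  · refine Subtype.ext (funext fun y => ?_)
    obtain ⟨i, hi⟩ := Opens.mem_iSup.1 y.2
    exact (congrFun (congrArg Subtype.val (hτ i)) ⟨y.1, hi⟩).trans
      (congrFun (hσ i) ⟨y.1, hi⟩).symm

/-- The structure sheaf `𝒪` of `ℙ¹ × ℙ²`. -/
def structureSheaf : Sheaf (Opens.grothendieckTopology X) RingCat.{0} :=
  ⟨structurePresheaf, isSheaf_structurePresheaf⟩

namespace FunctionModule

variable {W : Type} [AddCommGroup W] [Module ℂ W] (M : FunctionModule W)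

/-- The presheaf of abelian groups of a sheaf of functions. -/
def toAbPresheaf : (Opens X)ᵒᵖ ⥤ AddCommGrpCat.{0} where
  obj U := AddCommGrpCat.of (M.sec U.unop)
  map {U V} i := AddCommGrpCat.ofHom
    { toFun := fun σ => ⟨res i.unop.le σ.1, M.res_mem i.unop.le σ.1 σ.2⟩
      map_zero' := rfl
      map_add' := fun _ _ => rfl }

instance (U : (Opens X)ᵒᵖ) : Module (structureSheaf.obj.obj U) (M.toAbPresheaf.obj U) :=
  inferInstanceAs (Module (regular U.unop) (M.sec U.unop))

/-- The presheaf of `𝒪`-modules of a sheaf of functions. -/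
def toPresheaf : PresheafOfModules.{0} structureSheaf.obj :=
  PresheafOfModules.ofPresheaf M.toAbPresheaf (by intros; rfl)

lemma isSheaf_toAbPresheaf :
    Presheaf.IsSheaf (Opens.grothendieckTopology X) M.toAbPresheaf := by
  refine (TopCat.Presheaf.isSheaf_iff_isSheaf_comp (forget AddCommGrpCat)
    M.toAbPresheaf).2 ?_
  refine TopCat.Presheaf.isSheaf_of_isSheafUniqueGluing_types _ ?_
  intro ι U sf hsf
  obtain ⟨σ, hσ⟩ := exists_glue U (fun i => (sf i : M.sec (U i)).1) (fun i j y hi hj =>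
    congrFun (congrArg Subtype.val (hsf i j)) ⟨y, hi, hj⟩)
  refine ⟨(⟨σ, ?_⟩ : M.sec (iSup U)), fun i => Subtype.ext (hσ i), fun τ hτ => ?_⟩
  · refine M.of_local _ fun p hp => ?_
    obtain ⟨i, hi⟩ := Opens.mem_iSup.1 hp
    exact ⟨U i, le_iSup U i, hi, by rw [hσ]; exact (sf i : M.sec (U i)).2⟩
  · refine Subtype.ext (funext fun y => ?_)
    obtain ⟨i, hi⟩ := Opens.mem_iSup.1 y.2
    exact (congrFun (congrArg Subtype.val (hτ i)) ⟨y.1, hi⟩).trans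
      (congrFun (hσ i) ⟨y.1, hi⟩).symm

/-- The sheaf of `𝒪`-modules of a sheaf of functions. -/
def toSheaf : SheafOfModules.{0} structureSheaf := ⟨M.toPresheaf, M.isSheaf_toAbPresheaf⟩

end FunctionModule

/-- The sections of the direct sum of the `𝒪(d i)`: tuples whose `i`-th component is a section
of `𝒪(d i)`. -/
def twistSumFunctions {ι : Type} (d : ι → ℤ × ℤ) : FunctionModule (ι → ℂ) where
  sec U :=
    { carrier := {σ | ∀ i, IsSection (d i) (fun y => σ y i)}
      zero_mem' := fun _ => IsSection.zero
      add_mem' := fun h h' i => (h i).add (h' i)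
      smul_mem' := fun r σ h i => by have := IsSection.mul r.2 (h i); rwa [zero_add] at this }
  res_mem h σ hσ i := (hσ i).res h
  of_local σ hσ i := IsSection.of_local fun p hp => by
    obtain ⟨V, h, hpV, H⟩ := hσ p hp
    exact ⟨V, h, hpV, H i⟩

/-- The locally free sheaf `⨁ i, 𝒪(d i)` on `ℙ¹ × ℙ²`. -/
def twistSum {ι : Type} (d : ι → ℤ × ℤ) : SheafOfModules.{0} structureSheaf :=
  (twistSumFunctions d).toSheaf

/-- The regular functions that vanish at all points of `C`. -/
def idealFunctions (C : Set Pt) : FunctionModule ℂ where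
  sec U :=
    { carrier := {σ | IsSection 0 σ ∧ ∀ y : Over U, proj y.1 ∈ C → σ y = 0}
      zero_mem' := ⟨IsSection.zero, fun _ _ => rfl⟩
      add_mem' := fun h h' => ⟨h.1.add h'.1, fun y hy => by
        rw [Pi.add_apply, h.2 y hy, h'.2 y hy, add_zero]⟩
      smul_mem' := fun r σ h => ⟨by have := IsSection.mul r.2 h.1; rwa [add_zero] at this,
        fun y hy => show r.1 y * σ y = 0 by rw [h.2 y hy, mul_zero]⟩ }
  res_mem h σ hσ := ⟨hσ.1.res h, fun y hy => hσ.2 ⟨y.1, h y.2⟩ hy⟩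
  of_local σ hσ := ⟨IsSection.of_local fun p hp => by
      obtain ⟨V, h, hpV, H⟩ := hσ p hp
      exact ⟨V, h, hpV, H.1⟩,
    fun y hy => by
      obtain ⟨V, h, hpV, H⟩ := hσ _ y.2
      exact H.2 ⟨y.1, hpV⟩ hy⟩

/-- The ideal sheaf of `C` (with its reduced structure) in `ℙ¹ × ℙ²`. -/
def idealSheaf (C : Set Pt) : SheafOfModules.{0} structureSheaf := (idealFunctions C).toSheaf

/-! ### Matrices of bihomogeneous forms -/

section matrix

variable {m n : ℕ}

/-- Matrices of bihomogeneous forms that define morphisms `⨁ j, 𝒪(e j) ⟶ ⨁ i, 𝒪(d i)`: the entry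
in row `i` and column `j` has bidegree `d i - e j`. -/
abbrev FormMatrix (e : Fin n → ℤ × ℤ) (d : Fin m → ℤ × ℤ) : Type :=
  (i : Fin m) → (j : Fin n) → Forms (d i - e j)

variable {e : Fin n → ℤ × ℤ} {d : Fin m → ℤ × ℤ}

lemma isSection_mulVec (M : FormMatrix e d) {U : Opens X} (σ : Over U → Fin n → ℂ)
    (hσ : σ ∈ (twistSumFunctions e).sec U) (i : Fin m) :
    IsSection (d i) (fun y : Over U => ∑ j, val (M i j) y.1 * σ y j) := by
  have key : ∀ s : Finset (Fin n),
      IsSection (d i) (fun y : Over U => ∑ j ∈ s, val (M i j) y.1 * σ y j) := by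
    intro s
    induction s using Finset.induction_on with
    | empty => simpa using! IsSection.zero
    | insert j s hj ih =>
      simp only [Finset.sum_insert hj]
      refine IsSection.add (σ := fun y : Over U => val (M i j) y.1 * σ y j) ?_ ih
      have := IsSection.mul (IsSection.of_form (U := U) (M i j)) (hσ j)
      rwa [sub_add_cancel] at this
  exact key Finset.univ

/-- Multiplication of column vectors of sections over `U` by a matrix of forms. -/
def mulVec (M : FormMatrix e d) (U : Opens X) :
    (twistSumFunctions e).sec U →ₗ[regular U] (twistSumFunctions d).sec U where
  toFun σ := ⟨fun y i => ∑ j, val (M i j) y.1 * σ.1 y j, isSection_mulVec M σ.1 σ.2⟩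
  map_add' σ τ := Subtype.ext <| by
    funext y i
    simp [mul_add, Finset.sum_add_distrib]
  map_smul' r σ := Subtype.ext <| by
    funext y i
    change ∑ j, val (M i j) y.1 * (r.1 y * σ.1 y j) = r.1 y * ∑ j, val (M i j) y.1 * σ.1 y j
    rw [Finset.mul_sum]
    exact Finset.sum_congr rfl fun j _ => by ring

/-- The morphism of sheaves `⨁ j, 𝒪(e j) ⟶ ⨁ i, 𝒪(d i)` given by a matrix of forms. -/
def matrixHom (M : FormMatrix e d) : twistSum e ⟶ twistSum d where
  val := PresheafOfModules.homMk
    { app := fun U => AddCommGrpCat.ofHom (mulVec M U.unop).toAddMonoidHom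
      naturality := fun _ _ _ => rfl }
    (fun U r σ => (mulVec M U.unop).map_smul r σ)

/-- The matrix `M` presents the ideal sheaf of `C`, by a short exact sequence of sheaves
`0 ⟶ ⨁ j, 𝒪(e j) ⟶ ⨁ i, 𝒪(d i) ⟶ ℐ_C ⟶ 0` whose first morphism is given by `M`. -/
def Resolves (M : FormMatrix e d) (C : Set Pt) : Prop :=
  ∃ (ψ : twistSum d ⟶ idealSheaf C) (w : matrixHom M ≫ ψ = 0),
    (ShortComplex.mk (matrixHom M) ψ w).ShortExact

end matrix

/-! ### The Zariski topology on parameter spaces and rational curves -/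

/-- The ring of polynomial functions on a (finite-dimensional) complex vector space: the algebra
of functions generated by the linear forms. -/
def polyFunctions (V : Type) [AddCommGroup V] [Module ℂ V] : Subalgebra ℂ (V → ℂ) :=
  Algebra.adjoin ℂ (Set.range fun (l : Module.Dual ℂ V) (v : V) => l v)

/-- The Zariski topology on a (finite-dimensional) complex vector space. -/
abbrev zariski (V : Type) [AddCommGroup V] [Module ℂ V] : TopologicalSpace V :=
  generateFrom {U | ∃ h ∈ polyFunctions V, U = {v | h v ≠ 0}}

/-- The vector space of tuples of `n` binary forms of degree `k`. -/
abbrev BinaryForms (n k : ℕ) : Type :=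
  Fin n → MvPolynomial.homogeneousSubmodule (Fin 2) ℂ k

/-- The values of a tuple of binary forms. -/
def BinaryForms.value {n k : ℕ} (f : BinaryForms n k) (t : Fin 2 → ℂ) : Fin n → ℂ :=
  fun i => MvPolynomial.eval t (f i).1

/-- A parametrized rational curve of bidegree `(a, b)` in `ℙ¹ × ℙ²`: a morphism
`ℙ¹ ⟶ ℙ¹ × ℙ²`, `t ↦ ((f₀ t : f₁ t), (g₀ t : g₁ t : g₂ t))`, where the binary forms `fᵢ` of degree
`a` have no common zero in `ℙ¹`, and the binary forms `gⱼ` of degree `b` have no common zero. So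
`𝒪(1, 0)` and `𝒪(0, 1)` have degrees `a` and `b` on the parametrizing line. For coprime `a`, `b` the
morphism is birational onto its image, because the degree over the image divides `a` and `b`. -/
structure RationalCurve (a b : ℕ) where
  /-- the forms that define the morphism, as a point of a vector space -/
  forms : BinaryForms 2 a × BinaryForms 3 b
  fst_ne (t : Fin 2 → ℂ) : t ≠ 0 → forms.1.value t ≠ 0
  snd_ne (t : Fin 2 → ℂ) : t ≠ 0 → forms.2.value t ≠ 0

/-- The Zariski topology on the space of parametrized rational curves, as a subspace of the vector
space of forms (in which it is a nonempty open subset, hence irreducible). -/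
instance (a b : ℕ) : TopologicalSpace (RationalCurve a b) :=
  (zariski (BinaryForms 2 a × BinaryForms 3 b)).induced RationalCurve.forms

/-- The rational curve as a subset of `ℙ¹ × ℙ²`: the image of its parametrization. -/
def RationalCurve.carrier {a b : ℕ} (c : RationalCurve a b) : Set Pt :=
  {p | ∃ (t : Fin 2 → ℂ) (ht : t ≠ 0),
    proj (⟨c.forms.1.value t, c.fst_ne t ht⟩, ⟨c.forms.2.value t, c.snd_ne t ht⟩) = p}

/-- The degrees of `𝒪(-1, -4)^2`. -/
def syzDeg : Fin 2 → ℤ × ℤ := ![(-1, -4), (-1, -4)]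

/-- The degrees of `𝒪(0, -2) ⊕ 𝒪(-1, -3)^2`. -/
def genDeg : Fin 3 → ℤ × ℤ := ![(0, -2), (-1, -3), (-1, -3)]

end ProjLinePlane

end

noncomputable section

namespace ProjLinePlane

/-! ### Short exact sequences of sheaves of modules -/

/-! Write (s, x) for the coordinates of ℙ¹ × ℙ², l for the lower two rows of M and q = det l. If the
conic q = 0 is smooth, then at each of its points the matrix l(x) has a kernel spanned by one vector
t. This identifies the conic with ℙ¹; the inverse t ↦ g(t) is the cross product of the two linear
forms l · t. The first row times t, taken at x = g(t), has degree 1 in s and degree 5 in t, so it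
reads s₀ f₁(t) - s₁ f₀(t) and cuts out the graph of (f₀ : f₁) over the conic. So M determines the
forms (f, g), namely `curveForms`; `Parametrizes` records how M and the curve fit together.

For such a pair, M and its signed maximal minors form a Hilbert–Burch complex. Over the Cox ring it
is exact because q is prime and does not divide one of the other minors (`exists_eq_mul`). The
minors generate the forms vanishing on the curve only locally (`exists_mul_eq`): off the conic q is
invertible; at a point of the conic one of the other minors, being linear in s, eliminates s up to a
factor that is invertible there, and what is left vanishes on the conic, hence is divisible by q.
Clearing denominators carries this over to sheaves (`resolves_of_exact`).

The only genericity needed is that g₀, g₁, g₂ are linearly independent, that is, det `gram` ≠ 0.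
Every curve with this property comes from an explicit matrix (`exists_curveForms_eq`), which gives
(1). For (2), `curveForms` is polynomial in M, so an open condition on curves, together with the
nonvanishing of the resultant and of det `gram`, pulls back to an open condition on matrices. It is
satisfiable because the space of forms is irreducible and all nondegenerate pairs (f, g) are
reached. -/

/-- A morphism of sheaves of modules is an epimorphism if it is locally surjective. -/
lemma epi_of_local {A B : SheafOfModules.{0} structureSheaf} (φ : A ⟶ B)
    (h : ∀ (U : Opens X) (s : B.val.obj (op U)) (p : Pt), p ∈ U → ∃ (V : Opens X) (i : V ⟶ U), p ∈ V ∧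
      ∃ t : A.val.obj (op V), φ.val.app (op V) t = B.val.map i.op s) : Epi φ := by
  suffices Epi ((SheafOfModules.toSheaf structureSheaf).map φ) from
    (SheafOfModules.toSheaf structureSheaf).epi_of_epi_map this
  have : Sheaf.IsLocallySurjective ((SheafOfModules.toSheaf structureSheaf).map φ) := by
    refine ⟨fun {U} s p hp => ?_⟩
    obtain ⟨V, i, hV, t, ht⟩ := h U s p hp
    exact ⟨V, i, ⟨t, ht⟩, hV⟩
  infer_instance

lemma mono_of_injective {A B : SheafOfModules.{0} structureSheaf} (φ : A ⟶ B)
    (h : ∀ (U : Opens X), Function.Injective (φ.val.app (op U))) : Mono φ := by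
  suffices Mono ((SheafOfModules.forget structureSheaf).map φ) from
    (SheafOfModules.forget structureSheaf).mono_of_mono_map this
  exact PresheafOfModules.mono_of_injective fun U => h U.unop

lemma app_injective_of_mono {A B : SheafOfModules.{0} structureSheaf} (φ : A ⟶ B) [Mono φ]
    (U : Opens X) : Function.Injective (φ.val.app (op U)) := by
  have : Mono ((SheafOfModules.evaluation structureSheaf (op U)).map φ) := inferInstance
  exact (ModuleCat.mono_iff_injective _).1 this

/-- A complex of sheaves of modules is a short exact sequence if it is injective on sections on the
left, and sections lift locally in the middle and on the right. -/
lemma shortExact_of_local (S : ShortComplex (SheafOfModules.{0} structureSheaf))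
    (hf : ∀ (U : Opens X), Function.Injective (S.f.val.app (op U)))
    (hS : ∀ (U : Opens X) (s : S.X₂.val.obj (op U)) (p : Pt), p ∈ U →
      S.g.val.app (op U) s = 0 → ∃ (V : Opens X) (i : V ⟶ U), p ∈ V ∧
        ∃ t : S.X₁.val.obj (op V), S.f.val.app (op V) t = S.X₂.val.map i.op s)
    (hg : ∀ (U : Opens X) (s : S.X₃.val.obj (op U)) (p : Pt), p ∈ U →
      ∃ (V : Opens X) (i : V ⟶ U), p ∈ V ∧
        ∃ t : S.X₂.val.obj (op V), S.g.val.app (op V) t = S.X₃.val.map i.op s) :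
    S.ShortExact := by
  refine { exact := ?_, mono_f := mono_of_injective _ hf, epi_g := epi_of_local _ hg }
  -- Exactness in the middle means that the left term maps onto the kernel of `S.g`. The lift is
  -- produced in the middle term and then compared inside the kernel, whose inclusion is injective
  -- on sections.
  rw [S.exact_iff_epi_kernel_lift]
  refine epi_of_local _ fun U s p hp => ?_
  obtain ⟨V, i, hV, t, ht⟩ := hS U ((Limits.kernel.ι S.g).val.app (op U) s) p hp (by
    have := congrArg (fun φ => φ.val.app (op U) s) (Limits.kernel.condition S.g)
    exact this)
  refine ⟨V, i, hV, t, app_injective_of_mono (Limits.kernel.ι S.g) V ?_⟩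
  have h1 := congrArg (fun φ => φ.val.app (op V) t) (Limits.kernel.lift_ι S.g S.f S.zero)
  have h2 := PresheafOfModules.naturality_apply (Limits.kernel.ι S.g).val i.op s
  exact (h1.trans ht).trans h2.symm

/-! ### Bihomogeneous forms -/

lemma weight_bideg (μ : Fin 2 ⊕ Fin 3 →₀ ℕ) :
    Finsupp.weight bideg μ = ((μ (.inl 0) + μ (.inl 1) : ℤ),
      (μ (.inr 0) + μ (.inr 1) + μ (.inr 2) : ℤ)) := by
  rw [Finsupp.weight_apply, Finsupp.sum_fintype _ _ (by simp), Fintype.sum_sum_type,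
    Fin.sum_univ_two, Fin.sum_univ_three]
  ext <;> simp [bideg]

/-- The exponents of the monomials of a form of bidegree `d`. -/
lemma exponents_of_mem {d : ℤ × ℤ} {F : Cox} (hF : F ∈ Forms d) {μ : Fin 2 ⊕ Fin 3 →₀ ℕ}
    (hμ : μ ∈ F.support) : (μ (.inl 0) + μ (.inl 1) : ℤ) = d.1 ∧
      (μ (.inr 0) + μ (.inr 1) + μ (.inr 2) : ℤ) = d.2 := by
  have h : Finsupp.weight bideg μ = d := hF (MvPolynomial.mem_support_iff.1 hμ)
  rw [weight_bideg] at h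
  exact ⟨congrArg Prod.fst h, congrArg Prod.snd h⟩

lemma aeval_eq_sum {A : Type} [CommRing A] [Algebra ℂ A] (F : Cox) (s : Fin 2 → A)
    (x : Fin 3 → A) : MvPolynomial.aeval (Sum.elim s x) F =
      ∑ μ ∈ F.support, algebraMap ℂ A (F.coeff μ) * (s 0 ^ μ (.inl 0) * s 1 ^ μ (.inl 1) *
        (x 0 ^ μ (.inr 0) * x 1 ^ μ (.inr 1) * x 2 ^ μ (.inr 2))) := by
  rw [MvPolynomial.aeval_def, MvPolynomial.eval₂_eq']
  simp only [Fintype.prod_sum_type, Fin.prod_univ_two, Fin.prod_univ_three, Sum.elim_inl,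
    Sum.elim_inr]

/-- The scalars may lie in any algebra, because the line coordinates are later multiplied by a
polynomial. Using `toNat` is harmless: a form with a negative degree has no monomials. -/
lemma aeval_smul {A : Type} [CommRing A] [Algebra ℂ A] {d : ℤ × ℤ} {F : Cox} (hF : F ∈ Forms d)
    (a b : A) (s : Fin 2 → A) (x : Fin 3 → A) :
    MvPolynomial.aeval (Sum.elim (fun i => a * s i) (fun i => b * x i)) F =
      a ^ d.1.toNat * b ^ d.2.toNat * MvPolynomial.aeval (Sum.elim s x) F := by
  rw [aeval_eq_sum, aeval_eq_sum, Finset.mul_sum]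
  refine Finset.sum_congr rfl fun μ hμ => ?_
  obtain ⟨h1, h2⟩ := exponents_of_mem hF hμ
  rw [show d.1.toNat = μ (.inl 0) + μ (.inl 1) by omega,
    show d.2.toNat = μ (.inr 0) + μ (.inr 1) + μ (.inr 2) by omega]
  ring

lemma val_eq_aeval (F : Cox) (y : Coord) :
    val F y = MvPolynomial.aeval (Sum.elim y.1.1 y.2.1) F := by
  rw [val, MvPolynomial.aeval_eq_eval]

lemma val_ne_zero_of_proj_eq {d : ℤ × ℤ} (F : Forms d) {y z : Coord} (h : proj y = proj z)
    (hy : val F y ≠ 0) : val F z ≠ 0 := by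
  obtain ⟨a, ha⟩ := (Projectivization.mk_eq_mk_iff' ℂ _ _ y.1.2 z.1.2).1 (congrArg Pt.fst h)
  obtain ⟨b, hb⟩ := (Projectivization.mk_eq_mk_iff' ℂ _ _ y.2.2 z.2.2).1 (congrArg Pt.snd h)
  have key := aeval_smul F.2 a b z.1.1 z.2.1
  rw [val_eq_aeval, ← ha, ← hb] at hy
  intro h0
  rw [val_eq_aeval] at h0
  rw [h0, mul_zero] at key
  exact hy key

lemma exists_proj_eq (p : Pt) : ∃ y : Coord, proj y = p :=
  ⟨(⟨p.fst.rep, p.fst.rep_nonzero⟩, ⟨p.snd.rep, p.snd.rep_nonzero⟩),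
    Pt.ext (Projectivization.mk_rep _) (Projectivization.mk_rep _)⟩

/-- The open set where a form does not vanish. -/
def basicOpen {d : ℤ × ℤ} (G : Forms d) : Opens X :=
  ⟨{p | ∀ y, proj y = p → val G y ≠ 0}, .basic _ ⟨d, G, rfl⟩⟩

lemma proj_mem_basicOpen {d : ℤ × ℤ} {G : Forms d} {y : Coord} :
    proj y ∈ basicOpen G ↔ val G y ≠ 0 :=
  ⟨fun h => h y rfl, fun h _ hz => val_ne_zero_of_proj_eq G hz.symm h⟩

/-- The nonvanishing loci are not only a subbasis but a basis, since the locus of a product of forms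
is the intersection of the loci. -/
lemma exists_basicOpen_le {U : Opens X} {p : Pt} (hp : p ∈ U) :
    ∃ (d : ℤ × ℤ) (G : Forms d), p ∈ basicOpen G ∧ basicOpen G ≤ U := by
  obtain ⟨y, rfl⟩ := exists_proj_eq p
  obtain ⟨U, hU⟩ := U
  change proj y ∈ U at hp
  suffices ∃ (d : ℤ × ℤ) (G : Forms d), proj y ∈ basicOpen G ∧ (basicOpen G : Set Pt) ⊆ U from this
  induction hU with
  | basic s hs =>
    obtain ⟨d, G, rfl⟩ := hs
    exact ⟨d, G, hp, subset_rfl⟩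
  | univ =>
    exact ⟨0, ⟨1, MvPolynomial.isWeightedHomogeneous_one ℂ bideg⟩,
      proj_mem_basicOpen.2 (by simp [val]), Set.subset_univ _⟩
  | inter s t _ _ hs ht =>
    obtain ⟨d, G, hG, hGs⟩ := hs hp.1
    obtain ⟨e, H, hH, hHt⟩ := ht hp.2
    refine ⟨d + e, ⟨G * H, mul_mem G.2 H.2⟩, proj_mem_basicOpen.2 ?_, fun q hq => ?_⟩
    · rw [val_mul]
      exact mul_ne_zero (proj_mem_basicOpen.1 hG) (proj_mem_basicOpen.1 hH)
    · obtain ⟨z, rfl⟩ := exists_proj_eq q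
      have := proj_mem_basicOpen.1 hq
      rw [val_mul] at this
      exact ⟨hGs (proj_mem_basicOpen.2 (left_ne_zero_of_mul this)),
        hHt (proj_mem_basicOpen.2 (right_ne_zero_of_mul this))⟩
  | sUnion S _ ih =>
    obtain ⟨s, hs, hps⟩ := hp
    obtain ⟨d, G, hG, hGs⟩ := ih s hs hps
    exact ⟨d, G, hG, hGs.trans (Set.subset_sUnion_of_mem hs)⟩

lemma eq_zero_of_val_eq_zero {F H : Cox} (hH : H ≠ 0)
    (h : ∀ y, val H y ≠ 0 → val F y = 0) : F = 0 := by
  -- Homogeneous coordinates exclude the zero vectors; the two extra variables kill the points of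
  -- affine space where one of the two vectors might be zero.
  have : F * H * MvPolynomial.X (.inl 0) * MvPolynomial.X (.inr 0) = 0 := by
    refine MvPolynomial.funext fun v => ?_
    by_cases h0 : v (.inl 0) = 0
    · simp [h0]
    by_cases h1 : v (.inr 0) = 0
    · simp [h1]
    have hv : Sum.elim (fun i => v (.inl i)) (fun j => v (.inr j)) = v := by
      ext (i | j) <;> rfl
    have := h (⟨fun i => v (.inl i), fun h => h0 (congrFun h 0)⟩,
      ⟨fun j => v (.inr j), fun h => h1 (congrFun h 0)⟩)
    simp only [val, hv] at this
    by_cases h2 : MvPolynomial.eval v H = 0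
    · simp [h2]
    · simp [this h2]
  simpa [hH, MvPolynomial.X_ne_zero] using this

lemma ne_zero_of_mem_basicOpen {d : ℤ × ℤ} {G : Forms d} {p : Pt} (hp : p ∈ basicOpen G) :
    (G : Cox) ≠ 0 := by
  obtain ⟨y, rfl⟩ := exists_proj_eq p
  intro h
  exact proj_mem_basicOpen.1 hp (by simp [h, val])

lemma component_mul {d : ℤ × ℤ} {F : Cox} (hF : F ∈ Forms d) (e : ℤ × ℤ) (u : Cox) :
    MvPolynomial.weightedHomogeneousComponent bideg (d + e) (F * u) =
      F * MvPolynomial.weightedHomogeneousComponent bideg e u := by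
  classical
  ext μ
  have key : ∀ x ∈ Finset.HasAntidiagonal.antidiagonal μ, F.coeff x.1 *
      (MvPolynomial.weightedHomogeneousComponent bideg e u).coeff x.2 =
      if Finsupp.weight bideg μ = d + e then F.coeff x.1 * u.coeff x.2 else 0 := fun x hx => by
    by_cases h0 : F.coeff x.1 = 0
    · simp [h0]
    · have h1 : Finsupp.weight bideg x.1 = d := hF h0
      rw [MvPolynomial.coeff_weightedHomogeneousComponent, ← Finset.HasAntidiagonal.mem_antidiagonal.1 hx, map_add,
        h1]
      simp
  rw [MvPolynomial.coeff_weightedHomogeneousComponent, MvPolynomial.coeff_mul,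
    MvPolynomial.coeff_mul, Finset.sum_congr rfl key]
  split_ifs <;> simp

lemma component_mem (d : ℤ × ℤ) (u : Cox) :
    MvPolynomial.weightedHomogeneousComponent bideg d u ∈ Forms d :=
  MvPolynomial.weightedHomogeneousComponent_mem _ _ _

lemma component_of_mem {d : ℤ × ℤ} {u : Cox} (hu : u ∈ Forms d) :
    MvPolynomial.weightedHomogeneousComponent bideg d u = u :=
  MvPolynomial.IsWeightedHomogeneous.weightedHomogeneousComponent_same hu

/-- A linear equation with homogeneous coefficients that is soluble has a homogeneous solution. -/
lemma exists_homogeneous_solution {ι κ : Type} [Fintype κ] {a : ι → κ → ℤ × ℤ} (e : κ → ℤ × ℤ)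
    {d : ι → ℤ × ℤ} (h : ∀ i k, a i k + e k = d i) (A : ∀ i k, Forms (a i k)) (F : ∀ i, Forms (d i))
    (hs : ∃ u : κ → Cox, ∀ i, (F i : Cox) = ∑ k, (A i k * u k : Cox)) :
    ∃ u : ∀ k, Forms (e k), ∀ i, (F i : Cox) = ∑ k, (A i k * u k : Cox) := by
  obtain ⟨u, hu⟩ := hs
  -- Multiplication by a form shifts the grading, so taking the component of the right degree of
  -- each unknown preserves the equations.
  refine ⟨fun k => ⟨_, component_mem (e k) (u k)⟩, fun i => ?_⟩
  rw [← component_of_mem (F i).2, hu i, map_sum]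
  refine Finset.sum_congr rfl fun k _ => ?_
  rw [← h i k, component_mul (A i k).2]

/-! ### Sections as fractions with a common denominator -/

/-- A common denominator turns a linear relation between sections into one between their numerators,
to which exactness over the Cox ring applies. -/
lemma exists_fractions {n : ℕ} (d : Fin n → ℤ × ℤ) {U : Opens X} (σ : Fin n → Over U → ℂ)
    (hσ : ∀ j, IsSection (d j) (σ j)) {p : Pt} (hp : p ∈ U) :
    ∃ (e : ℤ × ℤ) (G : Forms e) (h : basicOpen G ≤ U), p ∈ basicOpen G ∧
      ∀ j, ∃ F : Forms (e + d j), ∀ y : Over (basicOpen G),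
        σ j ⟨y.1, h y.2⟩ = val F y.1 / val G y.1 := by
  induction n with
  | zero =>
    obtain ⟨e, G, hG, h⟩ := exists_basicOpen_le hp
    exact ⟨e, G, h, hG, fun j => j.elim0⟩
  | succ n ih =>
    obtain ⟨e, G, h, hG, H⟩ := ih (fun j => d j.succ) (fun j => σ j.succ) (fun j => hσ j.succ)
    obtain ⟨V, hV, e', F', G', hpV, H'⟩ := hσ 0 p hp
    obtain ⟨e'', G'', hG'', h''⟩ := exists_basicOpen_le hpV
    -- `G` and `G'` are the denominators of the old and the new components; `G''` shrinks the open
    -- set to one where the new fraction is valid.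
    obtain ⟨K, hK⟩ : ∃ K : Forms (e + e' + e''), (K : Cox) = G * G' * G'' :=
      ⟨⟨_, mul_mem (mul_mem G.2 G'.2) G''.2⟩, rfl⟩
    have hmul : ∀ y : Coord, val K y ≠ 0 →
        val G y ≠ 0 ∧ val G' y ≠ 0 ∧ val G'' y ≠ 0 := fun y hy => by
      rw [hK, val_mul, val_mul] at hy
      exact ⟨left_ne_zero_of_mul (left_ne_zero_of_mul hy),
        right_ne_zero_of_mul (left_ne_zero_of_mul hy), right_ne_zero_of_mul hy⟩
    have hle : basicOpen K ≤ basicOpen G := fun q hq => by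
      obtain ⟨z, rfl⟩ := exists_proj_eq q
      exact proj_mem_basicOpen.2 (hmul z (proj_mem_basicOpen.1 hq)).1
    refine ⟨e + e' + e'', K, hle.trans h, ?_, Fin.cases ?_ (fun j => ?_)⟩
    · obtain ⟨y, rfl⟩ := exists_proj_eq p
      refine proj_mem_basicOpen.2 ?_
      rw [hK, val_mul, val_mul]
      exact mul_ne_zero (mul_ne_zero (proj_mem_basicOpen.1 hG) (H' ⟨y, hpV⟩).1)
        (proj_mem_basicOpen.1 hG'')
    · refine ⟨⟨F' * (G * G''), ?_⟩, fun y => ?_⟩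
      · have := mul_mem F'.2 (mul_mem G.2 G''.2)
        rwa [show e' + d 0 + (e + e'') = e + e' + e'' + d 0 by abel] at this
      · obtain ⟨h1, h2, h3⟩ := hmul y.1 (proj_mem_basicOpen.1 y.2)
        have := (H' ⟨y.1, h'' (proj_mem_basicOpen.2 h3)⟩).2
        simp only [res] at this
        rw [this, hK]
        simp only [val_mul]
        field_simp
    · obtain ⟨F, hF⟩ := H j
      refine ⟨⟨F * (G' * G''), ?_⟩, fun y => ?_⟩
      · have := mul_mem F.2 (mul_mem G'.2 G''.2)
        rwa [show e + d j.succ + (e' + e'') = e + e' + e'' + d j.succ by abel] at this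
      · obtain ⟨h1, h2, h3⟩ := hmul y.1 (proj_mem_basicOpen.1 y.2)
        rw [hF ⟨y.1, hle y.2⟩, hK]
        simp only [val_mul]
        field_simp

lemma isSection_div {d e e' : ℤ × ℤ} (F : Forms e') (G : Forms e) (h : e' = e + d) {U : Opens X}
    (hU : U ≤ basicOpen G) : IsSection d (fun y : Over U => val F y.1 / val G y.1) := by
  subst h
  exact fun p hp => ⟨U, le_rfl, e, F, G, hp, fun y => ⟨proj_mem_basicOpen.1 (hU y.2), rfl⟩⟩

/-! ### Complexes of forms and short exact sequences of sheaves -/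

section complex

variable {m n : ℕ} {e : Fin n → ℤ × ℤ} {d : Fin m → ℤ × ℤ}

/-- A row of forms that vanish on `C` defines a morphism to the ideal sheaf of `C`. -/
def rowHom (R : (i : Fin m) → Forms (0 - d i)) (C : Set Pt)
    (hR : ∀ i y, proj y ∈ C → val (R i) y = 0) : twistSum d ⟶ idealSheaf C where
  val := PresheafOfModules.homMk
    { app := fun U => AddCommGrpCat.ofHom
        (X := (twistSumFunctions d).sec U.unop) (Y := (idealFunctions C).sec U.unop)
        { toFun := fun σ => ⟨fun y => ∑ i, val (R i) y.1 * σ.1 y i,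
            isSection_mulVec (d := fun _ : Fin 1 => 0) (fun _ => R) σ.1 σ.2 0,
            fun y hy => Finset.sum_eq_zero fun i _ => by rw [hR i y.1 hy, zero_mul]⟩
          map_zero' := Subtype.ext <| funext fun y => by simp
          map_add' := fun σ τ => Subtype.ext <| funext fun y => by
            simp [mul_add, Finset.sum_add_distrib] }
      naturality := fun _ _ _ => rfl }
    (fun U r σ => Subtype.ext <| funext fun y => by
      change ∑ i, val (R i) y.1 * (r.1 y * σ.1 y i) = r.1 y * ∑ i, val (R i) y.1 * σ.1 y i
      rw [Finset.mul_sum]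
      exact Finset.sum_congr rfl fun j _ => by ring)

lemma val_sum {ι : Type} (s : Finset ι) (F : ι → Cox) (y : Coord) :
    val (∑ i ∈ s, F i) y = ∑ i ∈ s, val (F i) y := by simp [val]

/-- Locally the section is F / G. The hypothesis on forms, applied to F G, gives D F G = ∑ Rᵢ bᵢ,
and the bᵢ / (D G²) are the lift. -/
lemma exists_local_lift (R : (i : Fin m) → Forms (0 - d i)) (C : Set Pt)
    (hsurj : ∀ (δ : ℤ × ℤ) (P : Forms δ), (∀ y, proj y ∈ C → val P y = 0) → ∀ y : Coord,
      ∃ (ε : ℤ × ℤ) (D : Forms ε), val D y ≠ 0 ∧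
        ∃ b : Fin m → Cox, (D * P : Cox) = ∑ i, (R i : Cox) * b i)
    {U : Opens X} (σ : Over U → ℂ) (hσ : IsSection 0 σ) (hσC : ∀ y : Over U, proj y.1 ∈ C → σ y = 0)
    {p : Pt} (hp : p ∈ U) : ∃ (V : Opens X) (h : V ≤ U), p ∈ V ∧
      ∃ τ : (twistSumFunctions d).sec V, ∀ y : Over V,
        ∑ i, val (R i) y.1 * τ.1 y i = σ ⟨y.1, h y.2⟩ := by
  obtain ⟨a, G, h, hG, H⟩ := exists_fractions (fun _ : Fin 1 => (0 : ℤ × ℤ))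
    (fun _ => σ) (fun _ => hσ) hp
  obtain ⟨F, H⟩ := H 0
  obtain ⟨z, hz⟩ := exists_proj_eq p
  rw [← hz] at hG
  have hF : (F : Cox) ∈ Forms a := by simpa only [add_zero] using F.2
  -- `F` is known to vanish on `C` only where `G` does not; the factor `G` takes care of the rest of
  -- `C`.
  obtain ⟨P, hP⟩ : ∃ P : Forms (a + a), (P : Cox) = F * G := ⟨⟨_, mul_mem hF G.2⟩, rfl⟩
  obtain ⟨ε, D, hD, hb⟩ := hsurj _ P (fun y hy => by
    rw [hP, val_mul]
    by_cases hy' : val G y = 0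
    · rw [hy', mul_zero]
    · have := H ⟨y, proj_mem_basicOpen.2 hy'⟩
      rw [hσC _ hy, eq_comm, div_eq_zero_iff] at this
      rw [this.resolve_right hy', zero_mul]) z
  obtain ⟨Q, hQ⟩ : ∃ Q : Forms (ε + (a + a)), (Q : Cox) = D * P :=
    ⟨⟨_, mul_mem D.2 P.2⟩, rfl⟩
  rw [← hQ] at hb
  obtain ⟨b, hb⟩ := exists_homogeneous_solution (ι := Unit)
    (fun i => ε + (a + a) + d i) (d := fun _ => ε + (a + a)) (fun _ i => by abel)
    (fun _ => R) (fun _ => Q) ⟨hb.choose, fun _ => hb.choose_spec⟩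
  replace hb := hb ()
  obtain ⟨E, hE⟩ : ∃ E : Forms (ε + (a + a)), (E : Cox) = D * (G * G) :=
    ⟨⟨_, mul_mem D.2 (mul_mem G.2 G.2)⟩, rfl⟩
  have hE' : ∀ y, val E y ≠ 0 → val D y ≠ 0 ∧ val G y ≠ 0 := fun y hy => by
    simp only [hE, val_mul] at hy
    exact ⟨left_ne_zero_of_mul hy, right_ne_zero_of_mul (right_ne_zero_of_mul hy)⟩
  have hle : basicOpen E ≤ basicOpen G := fun q hq => by
    obtain ⟨y, rfl⟩ := exists_proj_eq q
    exact proj_mem_basicOpen.2 (hE' y (proj_mem_basicOpen.1 hq)).2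
  have hGz := proj_mem_basicOpen.1 hG
  refine ⟨basicOpen E, hle.trans h, hz ▸ proj_mem_basicOpen.2 ?_,
    (⟨fun y i => val (b i) y.1 / val E y.1, fun i => isSection_div (b i) E
      (by abel) le_rfl⟩ : (twistSumFunctions d).sec (basicOpen E)), fun y => ?_⟩
  · simp only [hE, val_mul]
    exact mul_ne_zero hD (mul_ne_zero hGz hGz)
  change ∑ i, val (R i) y.1 * (val (b i) y.1 / val E y.1) = σ ⟨y.1, h (hle y.2)⟩
  obtain ⟨h1, h2⟩ := hE' y.1 (proj_mem_basicOpen.1 y.2)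
  have := congrArg (fun F => val F y.1) hb
  simp only [val_sum, val_mul, hQ, hP] at this
  simp only [← mul_div_assoc, ← Finset.sum_div]
  rw [H ⟨y.1, hle y.2⟩, ← this]
  simp only [hE, val_mul]
  field_simp

/-- If the sequence `Cox ^ n ⟶ Cox ^ m ⟶ Cox` defined by a matrix `M` and a row `R` of forms is exact
and injective on the left, and the entries of `R` generate the forms that vanish on `C` locally,
then `M` presents the ideal sheaf of `C`. -/
theorem resolves_of_exact (M : FormMatrix e d) (R : (i : Fin m) → Forms (0 - d i)) (C : Set Pt)
    (hC : ∀ i y, proj y ∈ C → val (R i) y = 0)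
    (hRM : ∀ j, ∑ i, (R i : Cox) * M i j = 0)
    (hinj : ∀ u : Fin n → Cox, (∀ i, ∑ j, (M i j : Cox) * u j = 0) → ∀ j, u j = 0)
    (hexact : ∀ F : Fin m → Cox, ∑ i, (R i : Cox) * F i = 0 →
      ∃ u : Fin n → Cox, ∀ i, F i = ∑ j, (M i j : Cox) * u j)
    (hsurj : ∀ (δ : ℤ × ℤ) (P : Forms δ), (∀ y, proj y ∈ C → val P y = 0) → ∀ y : Coord,
      ∃ (ε : ℤ × ℤ) (D : Forms ε), val D y ≠ 0 ∧
        ∃ b : Fin m → Cox, (D * P : Cox) = ∑ i, (R i : Cox) * b i) :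
    Resolves M C := by
  refine ⟨rowHom R C hC, ?_, shortExact_of_local _ ?_ ?_ ?_⟩
  · refine SheafOfModules.hom_ext (PresheafOfModules.hom_ext fun U => ?_)
    refine ModuleCat.hom_ext (LinearMap.ext fun (σ : (twistSumFunctions e).sec U.unop) => ?_)
    refine Subtype.ext (funext fun y => ?_)
    change ∑ i, val (R i) y.1 * ∑ j, val (M i j) y.1 * σ.1 y j = 0
    simp only [Finset.mul_sum, ← mul_assoc]
    rw [Finset.sum_comm]
    refine Finset.sum_eq_zero fun j _ => ?_
    have := congrArg (fun F => val F y.1) (hRM j)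
    simp only [val_sum, val_mul] at this
    rw [← Finset.sum_mul, this]
    simp [val]
  · intro U
    refine (injective_iff_map_eq_zero ((matrixHom M).val.app (op U)).hom).2
      fun (σ : (twistSumFunctions e).sec U) hσ => ?_
    have hσ' : ∀ (y : Over U) i, ∑ j, val (M i j) y.1 * σ.1 y j = 0 := fun y i =>
      congrFun (congrFun (congrArg Subtype.val hσ) y) i
    refine Subtype.ext (funext fun y => funext fun j => ?_)
    obtain ⟨a, G, h, hG, H⟩ := exists_fractions e (fun j y => σ.1 y j) σ.2 y.2
    choose F H using H
    -- The relation holds at all points where `G` is nonzero, hence identically between the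
    -- numerators.
    have hF : ∀ j, (F j : Cox) = 0 := hinj _ fun i => by
      refine eq_zero_of_val_eq_zero (ne_zero_of_mem_basicOpen hG) fun z hz => ?_
      have := hσ' ⟨z, h (proj_mem_basicOpen.2 hz)⟩ i
      simp only [H _ ⟨z, proj_mem_basicOpen.2 hz⟩] at this
      simp only [val_sum, val_mul]
      field_simp at this
      rw [← Finset.sum_div] at this
      simpa [hz] using this
    refine (H j ⟨y.1, hG⟩).trans ?_
    simp only [hF, val, map_zero, zero_div]
    rfl
  · intro U (σ : (twistSumFunctions d).sec U) p hp hσ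
    have hσ' : ∀ y : Over U, ∑ i, val (R i) y.1 * σ.1 y i = 0 := fun y =>
      congrFun (congrArg Subtype.val hσ) y
    obtain ⟨a, G, h, hG, H⟩ := exists_fractions d (fun j y => σ.1 y j) σ.2 hp
    choose F H using H
    obtain ⟨u, hu⟩ := exists_homogeneous_solution (fun j => a + e j) (d := fun i => a + d i)
      (fun i j => by abel) M F (hexact _ (by
        refine eq_zero_of_val_eq_zero (ne_zero_of_mem_basicOpen hG) fun z hz => ?_
        have := hσ' ⟨z, h (proj_mem_basicOpen.2 hz)⟩
        simp only [H _ ⟨z, proj_mem_basicOpen.2 hz⟩] at this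
        simp only [val_sum, val_mul]
        field_simp at this
        rw [← Finset.sum_div] at this
        simpa [hz] using this))
    refine ⟨basicOpen G, homOfLE h, hG,
      (⟨fun y j => val (u j) y.1 / val G y.1, fun j => isSection_div (u j) G rfl le_rfl⟩ :
        (twistSumFunctions e).sec (basicOpen G)), ?_⟩
    refine Subtype.ext (funext fun y => funext fun i => ?_)
    change ∑ j, val (M i j) y.1 * (val (u j) y.1 / val G y.1) = σ.1 ⟨y.1, h y.2⟩ i
    rw [H i y, hu i, val_sum, Finset.sum_div]
    exact Finset.sum_congr rfl fun j _ => by rw [val_mul, mul_div_assoc]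
  · intro U (σ : (idealFunctions C).sec U) p hp
    obtain ⟨V, h, hV, τ, hτ⟩ := exists_local_lift R C hsurj σ.1 σ.2.1 σ.2.2 hp
    exact ⟨V, homOfLE h, hV, τ, Subtype.ext (funext hτ)⟩

end complex

/-! ### Substitutions in bihomogeneous forms -/

/-- The value of a polynomial at a point of `ℂ² × ℂ³`. -/
abbrev evalAt (s : Fin 2 → ℂ) (x : Fin 3 → ℂ) : Cox →+* ℂ := MvPolynomial.eval (Sum.elim s x)

lemma evalAt_smul {d : ℤ × ℤ} {F : Cox} (hF : F ∈ Forms d) (a b : ℂ) (s : Fin 2 → ℂ)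
    (x : Fin 3 → ℂ) : evalAt (a • s) (b • x) F = a ^ d.1.toNat * b ^ d.2.toNat * evalAt s x F := by
  have := aeval_smul hF a b s x
  rwa [MvPolynomial.aeval_eq_eval, MvPolynomial.aeval_eq_eval] at this

lemma aeval_congr_of_fst_eq_zero {A : Type} [CommRing A] [Algebra ℂ A] {n : ℤ} {F : Cox}
    (hF : F ∈ Forms (0, n)) (s s' : Fin 2 → A) (x : Fin 3 → A) :
    MvPolynomial.aeval (Sum.elim s x) F = MvPolynomial.aeval (Sum.elim s' x) F := by
  rw [aeval_eq_sum, aeval_eq_sum]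
  refine Finset.sum_congr rfl fun μ hμ => ?_
  obtain ⟨h1, -⟩ := exponents_of_mem hF hμ
  rw [show μ (.inl 0) = 0 by simp only at h1; omega, show μ (.inl 1) = 0 by simp only at h1; omega]
  simp

lemma evalAt_congr {n : ℤ} {F : Cox} (hF : F ∈ Forms (0, n)) (s s' : Fin 2 → ℂ) (x : Fin 3 → ℂ) :
    evalAt s x F = evalAt s' x F := by
  have := aeval_congr_of_fst_eq_zero hF s s' x
  rwa [MvPolynomial.aeval_eq_eval, MvPolynomial.aeval_eq_eval] at this

/-- A form that is linear in the `sᵢ` is determined by its values at the unit vectors. -/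
lemma aeval_of_fst_eq_one {A : Type} [CommRing A] [Algebra ℂ A] {n : ℤ} {F : Cox}
    (hF : F ∈ Forms (1, n)) (s : Fin 2 → A) (x : Fin 3 → A) :
    MvPolynomial.aeval (Sum.elim s x) F = s 0 * MvPolynomial.aeval (Sum.elim ![1, 0] x) F +
      s 1 * MvPolynomial.aeval (Sum.elim ![0, 1] x) F := by
  rw [aeval_eq_sum, aeval_eq_sum, aeval_eq_sum, Finset.mul_sum, Finset.mul_sum,
    ← Finset.sum_add_distrib]
  refine Finset.sum_congr rfl fun μ hμ => ?_
  obtain ⟨h1, -⟩ := exponents_of_mem hF hμ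
  simp only at h1
  obtain ⟨h2, h3⟩ | ⟨h2, h3⟩ : (μ (.inl 0) = 0 ∧ μ (.inl 1) = 1) ∨
      (μ (.inl 0) = 1 ∧ μ (.inl 1) = 0) := by omega
  all_goals
    rw [h2, h3]
    simp
    ring

lemma aeval_of_snd_eq_one {A : Type} [CommRing A] [Algebra ℂ A] {F : Cox}
    (hF : F ∈ Forms (0, 1)) (s : Fin 2 → A) (x : Fin 3 → A) :
    MvPolynomial.aeval (Sum.elim s x) F =
      ∑ k, algebraMap ℂ A (evalAt 0 (Pi.single k 1) F) * x k := by
  have hk : ∀ k, evalAt 0 (Pi.single k 1) F =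
      MvPolynomial.aeval (Sum.elim (0 : Fin 2 → ℂ) (Pi.single k 1)) F := fun k => by
    rw [MvPolynomial.aeval_eq_eval]
  simp only [hk, aeval_eq_sum, map_sum, Finset.sum_mul]
  rw [Finset.sum_comm]
  refine Finset.sum_congr rfl fun μ hμ => ?_
  obtain ⟨h1, h2⟩ := exponents_of_mem hF hμ
  simp only at h1 h2
  have h3 : μ (.inl 0) = 0 := by omega
  have h4 : μ (.inl 1) = 0 := by omega
  obtain ⟨h5, h6, h7⟩ | ⟨h5, h6, h7⟩ | ⟨h5, h6, h7⟩ :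
      (μ (.inr 0) = 1 ∧ μ (.inr 1) = 0 ∧ μ (.inr 2) = 0) ∨
      (μ (.inr 0) = 0 ∧ μ (.inr 1) = 1 ∧ μ (.inr 2) = 0) ∨
      (μ (.inr 0) = 0 ∧ μ (.inr 1) = 0 ∧ μ (.inr 2) = 1) := by omega
  all_goals
    simp [h3, h4, h5, h6, h7, Fin.sum_univ_three]

lemma evalAt_of_snd_eq_one {F : Cox} (hF : F ∈ Forms (0, 1)) (s : Fin 2 → ℂ) (x : Fin 3 → ℂ) :
    evalAt s x F = ∑ k, evalAt 0 (Pi.single k 1) F * x k := by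
  have := aeval_of_snd_eq_one hF s x
  rwa [MvPolynomial.aeval_eq_eval] at this

lemma evalAt_of_fst_eq_one {n : ℤ} {F : Cox} (hF : F ∈ Forms (1, n)) (s : Fin 2 → ℂ)
    (x : Fin 3 → ℂ) : evalAt s x F = s 0 * evalAt ![1, 0] x F + s 1 * evalAt ![0, 1] x F := by
  have := aeval_of_fst_eq_one hF s x
  rwa [MvPolynomial.aeval_eq_eval, MvPolynomial.aeval_eq_eval, MvPolynomial.aeval_eq_eval] at this

/-- Substitution of constants for the `sᵢ`. -/
def substFst (v : Fin 2 → ℂ) : Cox →ₐ[ℂ] Cox :=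
  MvPolynomial.aeval (Sum.elim (fun i => MvPolynomial.C (v i)) (fun k => MvPolynomial.X (.inr k)))

lemma substFst_mem (v : Fin 2 → ℂ) {d : ℤ × ℤ} {F : Cox} (hF : F ∈ Forms d) :
    substFst v F ∈ Forms (0, d.2) := by
  rw [substFst, aeval_eq_sum]
  refine Submodule.sum_mem _ fun μ hμ => ?_
  obtain ⟨-, h2⟩ := exponents_of_mem hF hμ
  have hX : ∀ (k : Fin 3) (n : ℕ), (MvPolynomial.X (.inr k) ^ n : Cox) ∈ Forms (0, (n : ℤ)) :=
    fun k n => by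
      have := (MvPolynomial.isWeightedHomogeneous_X ℂ bideg (.inr k)).pow n
      simpa [bideg] using this
  rw [MvPolynomial.algebraMap_eq]
  simp only [← map_pow, ← map_mul, ← mul_assoc]
  rw [mul_assoc, mul_assoc]
  refine MvPolynomial.IsWeightedHomogeneous.C_mul ?_ _
  have := mul_mem (hX 0 (μ (.inr 0))) (mul_mem (hX 1 (μ (.inr 1))) (hX 2 (μ (.inr 2))))
  rwa [show ((0, (μ (.inr 0) : ℤ)) + ((0, (μ (.inr 1) : ℤ)) + (0, (μ (.inr 2) : ℤ))) : ℤ × ℤ) =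
    (0, d.2) by ext <;> simp; rw [← h2]; ring] at this

lemma evalAt_substFst (v : Fin 2 → ℂ) (F : Cox) (s : Fin 2 → ℂ) (x : Fin 3 → ℂ) :
    evalAt s x (substFst v F) = evalAt v x F := by
  rw [evalAt, substFst, ← MvPolynomial.aeval_eq_eval, MvPolynomial.comp_aeval_apply,
    ← MvPolynomial.aeval_eq_eval]
  congr 2
  ext (i | k) <;> simp

lemma eval_eq_of_totalDegree_le_one {σ : Type} [Fintype σ] (A : MvPolynomial σ ℂ)
    (hA : A.totalDegree ≤ 1) (v : σ → ℂ) :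
    MvPolynomial.eval v A = A.coeff 0 + ∑ i, A.coeff (Finsupp.single i 1) * v i := by
  classical
  have hsub : A.support ⊆ insert 0 (Finset.univ.image fun i => Finsupp.single i 1) := fun μ hμ => by
    have h1 : μ.degree ≤ 1 := (MvPolynomial.le_totalDegree hμ).trans hA
    obtain h | h : μ.degree = 0 ∨ μ.degree = 1 := by omega
    · simp [(Finsupp.degree_eq_zero_iff μ).1 h]
    · obtain ⟨i, rfl⟩ := (Finsupp.sum_eq_one_iff μ).1 h
      simp
  rw [MvPolynomial.eval_eq', Finset.sum_subset hsub fun μ _ hμ => by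
    rw [MvPolynomial.notMem_support_iff.1 hμ, zero_mul], Finset.sum_insert (by simp),
    Finset.sum_image fun i _ j _ h => Finsupp.single_left_injective one_ne_zero h]
  simp [Finsupp.single_apply, Finset.prod_ite_eq]

lemma BinaryForms.value_zero {n k : ℕ} (hk : k ≠ 0) (f : BinaryForms n k) : f.value 0 = 0 :=
  funext fun i => by
    change MvPolynomial.eval 0 (f i).1 = 0
    rw [MvPolynomial.eval_zero, MvPolynomial.constantCoeff_eq]
    exact MvPolynomial.IsHomogeneous.coeff_eq_zero (f i).2 (by simpa using hk.symm)

/-! ### Determinantal presentations of curves -/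

section determinantal

variable (M : FormMatrix syzDeg genDeg)

/-- The determinant of the lower two rows of `M`. -/
def conic : Cox := M 1 0 * M 2 1 - M 1 1 * M 2 0

/-- The maximal minor of `M` formed by the first row and the row with index `i + 1`. -/
def minor (i : Fin 2) : Cox := M 0 1 * M i.succ 0 - M 0 0 * M i.succ 1

variable {M}

lemma top_mem (j : Fin 2) : (M 0 j : Cox) ∈ Forms (1, 2) := by
  have h : genDeg 0 - syzDeg j = (1, 2) := by fin_cases j <;> rfl
  exact h ▸ (M 0 j).2

lemma lin_mem (i j : Fin 2) : (M i.succ j : Cox) ∈ Forms (0, 1) := by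
  have h : genDeg i.succ - syzDeg j = (0, 1) := by fin_cases i <;> fin_cases j <;> rfl
  exact h ▸ (M i.succ j).2

lemma conic_mem : conic M ∈ Forms (0, 2) :=
  sub_mem (mul_mem (lin_mem 0 0) (lin_mem 1 1)) (mul_mem (lin_mem 0 1) (lin_mem 1 0))

lemma minor_mem (i : Fin 2) : minor M i ∈ Forms (1, 3) :=
  sub_mem (mul_mem (top_mem 1) (lin_mem i 0)) (mul_mem (top_mem 0) (lin_mem i 1))

variable (M) in
/-- The matrix `M` and the curve `c` fit together: the kernel of the lower two rows at the point `x` of the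
plane is spanned by `t` exactly if `x` is the point of the conic with the parameter `t`, and the
first row then gives the equation of the graph of the component of `c` in the line. -/
structure Parametrizes (c : RationalCurve 5 2) : Prop where
  lin_mul (s t : Fin 2 → ℂ) (i : Fin 2) :
    ∑ j, evalAt s (c.forms.2.value t) (M i.succ j) * t j = 0
  eq_smul (s t : Fin 2 → ℂ) (x : Fin 3 → ℂ) : t ≠ 0 →
    (∀ i : Fin 2, ∑ j, evalAt s x (M i.succ j) * t j = 0) → ∃ b : ℂ, x = b • c.forms.2.value t
  top_mul (s t : Fin 2 → ℂ) : ∑ j, evalAt s (c.forms.2.value t) (M 0 j) * t j =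
    s 0 * c.forms.1.value t 1 - s 1 * c.forms.1.value t 0
  indep (β : Fin 3 → ℂ) : (∀ t, ∑ k, β k * c.forms.2.value t k = 0) → β = 0
  conic_ne_zero : conic M ≠ 0

namespace Parametrizes

variable {c : RationalCurve 5 2} (h : Parametrizes M c)

include h

/-- The lower 2 × 2 block at this point kills the nonzero vector t, so it is singular. -/
lemma evalAt_conic (s t : Fin 2 → ℂ) (ht : t ≠ 0) : evalAt s (c.forms.2.value t) (conic M) = 0 := by
  have h0 := h.lin_mul s t 0
  have h1 := h.lin_mul s t 1
  rw [Fin.sum_univ_two] at h0 h1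
  change evalAt s _ (M 1 0) * t 0 + evalAt s _ (M 1 1) * t 1 = 0 at h0
  change evalAt s _ (M 2 0) * t 0 + evalAt s _ (M 2 1) * t 1 = 0 at h1
  rw [conic, map_sub, map_mul, map_mul]
  by_contra hne
  refine ht (funext fun j => (mul_eq_zero.1 ?_).resolve_left hne)
  fin_cases j
  · change _ * t 0 = 0
    linear_combination evalAt s (c.forms.2.value t) (M 2 1) * h0 -
      evalAt s (c.forms.2.value t) (M 1 1) * h1
  · change _ * t 1 = 0
    linear_combination evalAt s (c.forms.2.value t) (M 1 0) * h1 -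
      evalAt s (c.forms.2.value t) (M 2 0) * h0

/-- A kernel vector of the singular lower block is the parameter. It comes with the scalar b because
x is an arbitrary representative of its point. -/
lemma exists_param {s : Fin 2 → ℂ} {x : Fin 3 → ℂ} (hx : evalAt s x (conic M) = 0) :
    ∃ (t : Fin 2 → ℂ) (b : ℂ), t ≠ 0 ∧ x = b • c.forms.2.value t ∧ ∀ i : Fin 2, ∑ j, evalAt s x (M i.succ j) * t j = 0 := by
  have hdet : (Matrix.of fun i j : Fin 2 => evalAt s x (M i.succ j)).det = 0 := by
    rw [Matrix.det_fin_two]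
    simpa [conic] using hx
  obtain ⟨t, ht, h0⟩ := Matrix.exists_mulVec_eq_zero_iff.2 hdet
  have h1 : ∀ i : Fin 2, ∑ j, evalAt s x (M i.succ j) * t j = 0 := fun i => congrFun h0 i
  obtain ⟨b, hb⟩ := h.eq_smul s t x ht h1
  exact ⟨t, b, ht, hb, h1⟩

-- The vectors orthogonal to t ≠ 0 in ℂ² are the multiples of (t₁, -t₀). This gives the factor κ by
-- which a minor differs from the equation of the graph.
omit h in
lemma eq_smul_of_mul_eq_zero {t v : Fin 2 → ℂ} (ht : t ≠ 0) (hv : ∑ j, v j * t j = 0) :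
    ∃ κ : ℂ, v 0 = κ * t 1 ∧ v 1 = -(κ * t 0) := by
  rw [Fin.sum_univ_two] at hv
  by_cases h0 : t 0 = 0
  · have h1 : t 1 ≠ 0 := fun h1 => ht (funext fun j => by fin_cases j <;> assumption)
    refine ⟨v 0 / t 1, by field_simp, ?_⟩
    rw [h0, mul_zero, zero_add] at hv
    simp [h0, (mul_eq_zero.1 hv).resolve_right h1]
  · refine ⟨-(v 1 / t 0), ?_, by field_simp⟩
    field_simp
    linear_combination hv

/-- The minor at a point of the conic in terms of the equation of the graph. -/
lemma evalAt_minor {s t : Fin 2 → ℂ} {i : Fin 2} {b κ : ℂ}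
    (h0 : evalAt s (b • c.forms.2.value t) (M i.succ 0) = κ * t 1)
    (h1 : evalAt s (b • c.forms.2.value t) (M i.succ 1) = -(κ * t 0)) :
    evalAt s (b • c.forms.2.value t) (minor M i) =
      κ * b ^ 2 * (s 0 * c.forms.1.value t 1 - s 1 * c.forms.1.value t 0) := by
  rw [← h.top_mul s t, minor, map_sub, map_mul, map_mul, h0, h1, Fin.sum_univ_two]
  have h2 : ∀ j, evalAt s (b • c.forms.2.value t) (M 0 j) =
      b ^ 2 * evalAt s (c.forms.2.value t) (M 0 j) := fun j => by
    have := evalAt_smul (top_mem (M := M) j) 1 b s (c.forms.2.value t)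
    simpa using this
  rw [h2, h2]
  ring

/-- After substituting g(t), the constant, the part linear in s and the part quadratic in t can be
separated by setting s or t to zero; the last one vanishes by independence of the gₖ. -/
lemma eq_zero_of_totalDegree_le_one {A : Cox} (hA : A.totalDegree ≤ 1)
    (h0 : ∀ s t, evalAt s (c.forms.2.value t) A = 0) : A = 0 := by
  have hg : c.forms.2.value 0 = 0 := BinaryForms.value_zero two_ne_zero _
  have key : ∀ (s t : Fin 2 → ℂ), A.coeff 0 + (∑ i, A.coeff (Finsupp.single (.inl i) 1) * s i +
      ∑ k, A.coeff (Finsupp.single (.inr k) 1) * c.forms.2.value t k) = 0 := fun s t => by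
    rw [← h0 s t, eval_eq_of_totalDegree_le_one A hA, Fintype.sum_sum_type]
    simp
  have h1 : A.coeff 0 = 0 := by simpa [hg] using key 0 0
  have h2 : ∀ i, A.coeff (Finsupp.single (.inl i) 1) = 0 := fun i => by
    simpa [hg, h1, Pi.single_apply] using key (Pi.single i 1) 0
  have h3 := h.indep (fun k => A.coeff (Finsupp.single (.inr k) 1)) fun t => by
    simpa [h1] using key 0 t
  refine MvPolynomial.funext fun v => ?_
  rw [eval_eq_of_totalDegree_le_one A hA, Fintype.sum_sum_type]
  simp [h1, h2, fun k => congrFun h3 k]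

/-- Substituting the parametrization kills the conic and lands in a domain, so it kills one of two
factors. A nonzero polynomial of total degree at most 1 is never killed, so that factor has degree 2
and the other is constant. -/
lemma irreducible_conic : Irreducible (conic M) := by
  have hdeg : (conic M).totalDegree ≤ 2 := by
    refine Finset.sup_le fun μ hμ => ?_
    obtain ⟨h1, h2⟩ := exponents_of_mem conic_mem hμ
    rw [Finsupp.sum_fintype _ _ (by simp), Fintype.sum_sum_type, Fin.sum_univ_two,
      Fin.sum_univ_three]
    simp only at h1 h2
    omega
  let π : Cox →ₐ[ℂ] MvPolynomial (Fin 2 ⊕ Fin 2) ℂ := MvPolynomial.aeval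
    (Sum.elim (fun i => MvPolynomial.X (.inl i)) (fun k => MvPolynomial.rename Sum.inr (c.forms.2 k).1))
  have hπ : ∀ A v, MvPolynomial.eval v (π A) =
      evalAt (fun i => v (.inl i)) (c.forms.2.value (fun j => v (.inr j))) A := fun A v => by
    rw [evalAt, ← MvPolynomial.aeval_eq_eval, MvPolynomial.comp_aeval_apply,
      ← MvPolynomial.aeval_eq_eval]
    congr 2
    ext (i | k)
    · simp
    · simp [BinaryForms.value, MvPolynomial.aeval_rename, MvPolynomial.aeval_eq_eval, Function.comp_def]
  have hπ0 : π (conic M) = 0 := by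
    -- The extra variable disposes of t = 0, which is not a parameter.
    have : π (conic M) * MvPolynomial.X (.inr 0) = 0 := MvPolynomial.funext fun v => by
      by_cases hv : v (.inr 0) = 0
      · simp [hv]
      · rw [map_mul, hπ, h.evalAt_conic _ _ fun hv' => hv (congrFun hv' 0)]
        simp
    simpa [MvPolynomial.X_ne_zero] using this
  have hker : ∀ A, π A = 0 → A.totalDegree ≤ 1 → A = 0 := fun A hA hA1 =>
    h.eq_zero_of_totalDegree_le_one hA1 fun s t => by
      have := hπ A (Sum.elim s t)
      rw [hA, map_zero] at this
      exact this.symm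
  refine ⟨fun hu => ?_, fun A B hAB => ?_⟩
  · have h0 : evalAt 0 0 (conic M) = 0 := by
      have := evalAt_smul conic_mem 1 0 0 0 (F := conic M)
      simpa using this
    exact (hu.map (evalAt 0 0)).ne_zero h0
  · have hne := h.conic_ne_zero
    rw [hAB] at hne
    have hA := left_ne_zero_of_mul hne
    have hB := right_ne_zero_of_mul hne
    rw [hAB, MvPolynomial.totalDegree_mul_of_isDomain hA hB] at hdeg
    have hunit : ∀ E : Cox, E ≠ 0 → E.totalDegree = 0 → IsUnit E := fun E hE hE0 => by
      rw [MvPolynomial.totalDegree_eq_zero_iff_eq_C.1 hE0] at hE ⊢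
      exact (isUnit_iff_ne_zero.2 fun h0 => hE (by rw [h0, map_zero])).map MvPolynomial.C
    rw [hAB, map_mul, mul_eq_zero] at hπ0
    rcases hπ0 with h0 | h0
    · have : ¬ A.totalDegree ≤ 1 := fun h1 => hA (hker A h0 h1)
      exact .inr (hunit B hB (by omega))
    · have : ¬ B.totalDegree ≤ 1 := fun h1 => hB (hker B h0 h1)
      exact .inl (hunit A hA (by omega))

lemma prime_conic : Prime (conic M) := h.irreducible_conic.prime

/-- A linear form in the coordinates of the plane that vanishes on the conic is zero. -/
lemma eq_zero_of_linear {F : Cox} (hF : F ∈ Forms (0, 1))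
    (h0 : ∀ s t, t ≠ 0 → evalAt s (c.forms.2.value t) F = 0) : F = 0 := by
  have hβ := h.indep (fun k => evalAt 0 (Pi.single k 1) F) fun t => by
    by_cases ht : t = 0
    · rw [ht, BinaryForms.value_zero two_ne_zero]
      simp
    · rw [← evalAt_of_snd_eq_one hF 0, h0 0 t ht]
  refine MvPolynomial.funext fun v => ?_
  have hv : Sum.elim (fun i => v (.inl i)) (fun k => v (.inr k)) = v := by
    ext (i | k) <;> rfl
  have := evalAt_of_snd_eq_one hF (fun i => v (.inl i)) (fun k => v (.inr k))
  rw [evalAt, hv] at this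
  rw [this]
  simp [fun k => congrFun hβ k]

/-- A polynomial that vanishes on the conic is divisible by its equation. -/
lemma conic_dvd {T : Cox} (hT : ∀ s x, x ≠ 0 → evalAt s x (conic M) = 0 → evalAt s x T = 0) :
    conic M ∣ T := by
  -- The factor x₀ covers x = 0, where nothing is assumed about `T`. The Nullstellensatz and
  -- primality then give q ∣ T or q ∣ x₀, and the latter fails because no nonzero linear form
  -- vanishes on the conic.
  have : (T * MvPolynomial.X (.inr 0) : Cox) ∈ MvPolynomial.vanishingIdeal ℂ
      (MvPolynomial.zeroLocus ℂ (Ideal.span {conic M})) := by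
    rw [MvPolynomial.mem_vanishingIdeal_iff]
    intro v hv
    have hv0 : MvPolynomial.eval v (conic M) = 0 := by
      have := hv _ (Ideal.mem_span_singleton_self _)
      rwa [MvPolynomial.aeval_eq_eval] at this
    rw [MvPolynomial.aeval_eq_eval]
    by_cases h0 : v (.inr 0) = 0
    · simp [h0]
    · have hv' : Sum.elim (fun i => v (.inl i)) (fun k => v (.inr k)) = v := by
        ext (i | k) <;> rfl
      have := hT (fun i => v (.inl i)) (fun k => v (.inr k)) (fun hx => h0 (congrFun hx 0))
        (by rwa [evalAt, hv'])
      rw [evalAt, hv'] at this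
      change MvPolynomial.eval v _ = 0
      rw [map_mul, this, zero_mul]
  have hp : (Ideal.span {conic M}).IsPrime :=
    (Ideal.span_singleton_prime h.conic_ne_zero).2 h.prime_conic
  rw [MvPolynomial.vanishingIdeal_zeroLocus_eq_radical, hp.radical, Ideal.mem_span_singleton] at this
  refine (h.prime_conic.dvd_or_dvd this).resolve_right fun hd => ?_
  refine MvPolynomial.X_ne_zero (R := ℂ) (Sum.inr 0 : Fin 2 ⊕ Fin 3)
    (h.eq_zero_of_linear (MvPolynomial.isWeightedHomogeneous_X ℂ bideg (.inr 0)) fun s t ht => ?_)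
  obtain ⟨B, hB⟩ := hd
  rw [hB, map_mul, h.evalAt_conic s t ht, zero_mul]

/-- Otherwise κ (s₀ f₁(t) - s₁ f₀(t)) would vanish for all s and all t ≠ 0. Since f(t) ≠ 0, this
forces κ = 0, so the row of linear forms in this minor vanishes along the conic; then it is zero,
and so is q. -/
lemma not_conic_dvd_minor : ¬ conic M ∣ minor M 0 := by
  rintro ⟨B, hB⟩
  have h0 : ∀ t, t ≠ 0 → ∀ s, evalAt s (c.forms.2.value t) (M 1 0) = 0 ∧
      evalAt s (c.forms.2.value t) (M 1 1) = 0 := fun t ht s => by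
    obtain ⟨κ, h0, h1⟩ := eq_smul_of_mul_eq_zero ht (h.lin_mul s t 0)
    suffices κ = 0 from ⟨h0.trans (by simp [this]), h1.trans (by simp [this])⟩
    have key : ∀ s' : Fin 2 → ℂ, κ * (s' 0 * c.forms.1.value t 1 - s' 1 * c.forms.1.value t 0) = 0 := fun s' => by
      have := h.evalAt_minor (s := s') (t := t) (i := 0) (b := 1) (κ := κ)
        (by rw [one_smul, ← h0]; exact evalAt_congr (lin_mem 0 0) _ _ _)
        (by rw [one_smul, ← h1]; exact evalAt_congr (lin_mem 0 1) _ _ _)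
      rw [one_smul, hB, map_mul, h.evalAt_conic s' t ht, zero_mul] at this
      simpa using this.symm
    by_contra hκ
    refine c.fst_ne t ht (funext fun i => ?_)
    fin_cases i
    · simpa [hκ] using key ![0, 1]
    · simpa [hκ] using key ![1, 0]
  have h1 := h.eq_zero_of_linear (lin_mem 0 0) fun s t ht => (h0 t ht s).1
  have h2 := h.eq_zero_of_linear (lin_mem 0 1) fun s t ht => (h0 t ht s).2
  refine h.conic_ne_zero ?_
  change (M 1 0 : Cox) = 0 at h1
  change (M 1 1 : Cox) = 0 at h2
  rw [conic, h1, h2, zero_mul, zero_mul, sub_zero]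

end Parametrizes

end determinantal

/-! ### Exactness of the Hilbert–Burch complex and local generation by the minors -/

section resolution

variable {M : FormMatrix syzDeg genDeg}

variable (M) in
/-- The row of the signed maximal minors of `M`. -/
def minorRow : (i : Fin 3) → Forms (0 - genDeg i) :=
  Fin.cons ⟨conic M, conic_mem⟩ (Fin.cons ⟨minor M 1, minor_mem 1⟩
    (Fin.cons ⟨-minor M 0, neg_mem (minor_mem 0)⟩ finZeroElim))

lemma sum_minorRow (b : Fin 3 → Cox) : ∑ i, (minorRow M i : Cox) * b i =
    conic M * b 0 + minor M 1 * b 1 - minor M 0 * b 2 := by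
  rw [Fin.sum_univ_three]
  change conic M * b 0 + minor M 1 * b 1 + -minor M 0 * b 2 = _
  ring

/-- Laplace expansion of a 3 × 3 determinant with a repeated column. -/
lemma minorRow_mul (j : Fin 2) : ∑ i, (minorRow M i : Cox) * M i j = 0 := by
  rw [sum_minorRow (fun i => M i j), conic, minor, minor]
  change _ + ((M 0 1 : Cox) * M 2 0 - M 0 0 * M 2 1) * M 1 j - (M 0 1 * M 1 0 - M 0 0 * M 1 1) * M 2 j = 0
  fin_cases j
  · change (M 1 0 * M 2 1 - M 1 1 * M 2 0 : Cox) * M 0 0 + ((M 0 1 : Cox) * M 2 0 - M 0 0 * M 2 1) * M 1 0 -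
      (M 0 1 * M 1 0 - M 0 0 * M 1 1) * M 2 0 = 0
    ring
  · change (M 1 0 * M 2 1 - M 1 1 * M 2 0 : Cox) * M 0 1 + ((M 0 1 : Cox) * M 2 0 - M 0 0 * M 2 1) * M 1 1 -
      (M 0 1 * M 1 0 - M 0 0 * M 1 1) * M 2 1 = 0
    ring

namespace Parametrizes

variable {c : RationalCurve 5 2} (h : Parametrizes M c)

include h

/-- Cramer's rule for the lower two rows gives q uⱼ = 0. -/
lemma eq_zero_of_mul_eq_zero (u : Fin 2 → Cox) (hu : ∀ i, ∑ j, (M i j : Cox) * u j = 0) (j : Fin 2) :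
    u j = 0 := by
  have h1 := hu 1
  have h2 := hu 2
  rw [Fin.sum_univ_two] at h1 h2
  refine (mul_eq_zero.1 (?_ : conic M * u j = 0)).resolve_left h.conic_ne_zero
  rw [conic]
  fin_cases j
  · change _ * u 0 = 0
    linear_combination (M 2 1 : Cox) * h1 - (M 1 1 : Cox) * h2
  · change _ * u 1 = 0
    linear_combination (M 1 0 : Cox) * h2 - (M 2 0 : Cox) * h1

/-- Cramer's rule for the lower two rows dictates the solution as fractions with denominator q. The
relation makes `minor M 0` times each numerator a multiple of q; as q is prime and does not divide
this minor, the fractions are polynomials. The equation of the first row is then the relation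
itself. -/
lemma exists_eq_mul (F : Fin 3 → Cox) (hF : ∑ i, (minorRow M i : Cox) * F i = 0) :
    ∃ u : Fin 2 → Cox, ∀ i, F i = ∑ j, (M i j : Cox) * u j := by
  rw [sum_minorRow] at hF
  have hm0 : minor M 0 = M 0 1 * M 1 0 - M 0 0 * M 1 1 := rfl
  have hm1 : minor M 1 = M 0 1 * M 2 0 - M 0 0 * M 2 1 := rfl
  have hq : conic M = M 1 0 * M 2 1 - M 1 1 * M 2 0 := rfl
  obtain ⟨u0, hu0⟩ : conic M ∣ M 2 1 * F 1 - M 1 1 * F 2 := by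
    refine (h.prime_conic.dvd_or_dvd (?_ : conic M ∣ minor M 0 * _)).resolve_left
      h.not_conic_dvd_minor
    refine ⟨M 0 1 * F 1 - M 1 1 * F 0, ?_⟩
    rw [hm0, hm1, hq] at hF
    rw [hm0, hq]
    linear_combination (M 1 1 : Cox) * hF
  obtain ⟨u1, hu1⟩ : conic M ∣ M 1 0 * F 2 - M 2 0 * F 1 := by
    refine (h.prime_conic.dvd_or_dvd (?_ : conic M ∣ minor M 0 * _)).resolve_left
      h.not_conic_dvd_minor
    refine ⟨M 1 0 * F 0 - M 0 0 * F 1, ?_⟩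
    rw [hm0, hm1, hq] at hF
    rw [hm0, hq]
    linear_combination (-M 1 0 : Cox) * hF
  refine ⟨![u0, u1], fun i => mul_left_cancel₀ h.conic_ne_zero ?_⟩
  rw [Fin.sum_univ_two]
  simp only [Matrix.cons_val_zero, Matrix.cons_val_one]
  rw [mul_add, mul_left_comm, mul_left_comm (conic M), ← hu0, ← hu1]
  fin_cases i
  · change conic M * F 0 = M 0 0 * _ + M 0 1 * _
    rw [hm0, hm1] at hF
    linear_combination hF
  · change conic M * F 1 = M 1 0 * _ + M 1 1 * _
    rw [hq]
    ring
  · change conic M * F 2 = M 2 0 * _ + M 2 1 * _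
    rw [hq]
    ring

/-- The minors of `M` vanish on the curve. -/
lemma val_minorRow (i : Fin 3) (y : Coord) (hy : proj y ∈ c.carrier) : val (minorRow M i) y = 0 := by
  obtain ⟨t, ht, hp⟩ := hy
  by_contra hne
  refine val_ne_zero_of_proj_eq (minorRow M i) hp.symm hne ?_
  change evalAt (c.forms.1.value t) (c.forms.2.value t) (minorRow M i) = 0
  have hm : ∀ j, evalAt (c.forms.1.value t) (c.forms.2.value t) (minor M j) = 0 := fun j => by
    obtain ⟨κ, h0, h1⟩ := eq_smul_of_mul_eq_zero ht (h.lin_mul (c.forms.1.value t) t j)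
    have := h.evalAt_minor (b := 1) (by rwa [one_smul]) (by rwa [one_smul])
    rw [one_smul] at this
    rw [this]
    ring
  fin_cases i
  · exact h.evalAt_conic _ t ht
  · exact hm 1
  · change evalAt (c.forms.1.value t) (c.forms.2.value t) (-minor M 0) = 0
    rw [map_neg, hm, neg_zero]

omit h in
/-- The coefficients of a minor with respect to the coordinates of the line. -/
lemma exists_minor_eq (i : Fin 2) : ∃ h0 h1 : Forms (0, 3),
    minor M i = MvPolynomial.X (.inl 0) * (h0 : Cox) + MvPolynomial.X (.inl 1) * (h1 : Cox) ∧
    (∀ s x, evalAt s x h0 = evalAt ![1, 0] x (minor M i)) ∧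
    (∀ s x, evalAt s x h1 = evalAt ![0, 1] x (minor M i)) := by
  refine ⟨⟨_, substFst_mem ![1, 0] (minor_mem i)⟩, ⟨_, substFst_mem ![0, 1] (minor_mem i)⟩,
    MvPolynomial.funext fun v => ?_, evalAt_substFst _ _, evalAt_substFst _ _⟩
  have hv : Sum.elim (fun i => v (.inl i)) (fun k => v (.inr k)) = v := by
    ext (i | k) <;> rfl
  have h1 := evalAt_of_fst_eq_one (minor_mem (M := M) i) (fun i => v (.inl i)) (fun k => v (.inr k))
  have h2 := fun w => evalAt_substFst w (minor M i) (fun i => v (.inl i)) (fun k => v (.inr k))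
  simp only [evalAt, hv] at h1 h2
  simp [h1, h2]

/-- The elimination of the coordinates of the line from a form that vanishes on the curve. -/
lemma conic_dvd_aeval {δ : ℤ × ℤ} {P : Forms δ} (hP : ∀ y, proj y ∈ c.carrier → val P y = 0)
    {i : Fin 2} {h0 h1 : Cox} (hh0 : ∀ s x, evalAt s x h0 = evalAt ![1, 0] x (minor M i))
    (hh1 : ∀ s x, evalAt s x h1 = evalAt ![0, 1] x (minor M i)) (z : Cox) :
    conic M ∣ MvPolynomial.aeval (Sum.elim ![-(z * h1), z * h0]
      (fun k => MvPolynomial.X (.inr k))) (P : Cox) := by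
  refine h.conic_dvd fun s x _ hx => ?_
  obtain ⟨t, b, ht, rfl, hk⟩ := h.exists_param hx
  obtain ⟨κ, hκ0, hκ1⟩ := eq_smul_of_mul_eq_zero ht (hk i)
  have hm : ∀ s', evalAt s' (b • c.forms.2.value t) (minor M i) =
      κ * b ^ 2 * (s' 0 * c.forms.1.value t 1 - s' 1 * c.forms.1.value t 0) := fun s' =>
    h.evalAt_minor (by rw [← hκ0]; exact evalAt_congr (lin_mem i 0) _ _ _)
      (by rw [← hκ1]; exact evalAt_congr (lin_mem i 1) _ _ _)
  -- At the point with parameter t, the vector (-h₁, h₀) equals κ b² f(t), so the substitution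
  -- amounts to evaluating `P` at a point over the curve, up to a scalar.
  have h2 : evalAt s (b • c.forms.2.value t) (MvPolynomial.aeval (Sum.elim ![-(z * h1), z * h0]
      (fun k => MvPolynomial.X (.inr k))) (P : Cox)) =
      evalAt ((evalAt s (b • c.forms.2.value t) z * (κ * b ^ 2)) • c.forms.1.value t)
        (b • c.forms.2.value t) P := by
    rw [evalAt, ← MvPolynomial.aeval_eq_eval, MvPolynomial.comp_aeval_apply, evalAt,
      ← MvPolynomial.aeval_eq_eval]
    congr 2
    ext (j | k)
    · have e0 := (hh0 s (b • c.forms.2.value t)).trans (hm _)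
      have e1 := (hh1 s (b • c.forms.2.value t)).trans (hm _)
      simp only [evalAt] at e0 e1
      fin_cases j
      · simp [MvPolynomial.aeval_eq_eval, e1]
        ring
      · simp [MvPolynomial.aeval_eq_eval, e0]
        ring
    · simp
  rw [h2, evalAt_smul P.2]
  have h3 : evalAt (c.forms.1.value t) (c.forms.2.value t) P = 0 := hP (⟨_, c.fst_ne t ht⟩, ⟨_, c.snd_ne t ht⟩) ⟨t, ht, rfl⟩
  rw [h3, mul_zero]

-- Polynomial expressions respect congruences modulo p.
omit h in
lemma dvd_aeval_sub_aeval {A B : Type} [CommRing A] [Algebra ℂ A] (F : MvPolynomial B ℂ) {p : A} {v w : B → A}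
    (hvw : ∀ i, p ∣ v i - w i) : p ∣ MvPolynomial.aeval v F - MvPolynomial.aeval w F := by
  rw [← Ideal.mem_span_singleton, ← Ideal.Quotient.mk_eq_mk_iff_sub_mem]
  have : ∀ u : B → A, Ideal.Quotient.mk (Ideal.span {p}) (MvPolynomial.aeval u F) =
      MvPolynomial.aeval (fun i => Ideal.Quotient.mk (Ideal.span {p}) (u i)) F := fun u =>
    MvPolynomial.comp_aeval_apply _ (Ideal.Quotient.mkₐ ℂ (Ideal.span {p})) F
  rw [this, this]
  congr 2
  ext i
  rw [Ideal.Quotient.mk_eq_mk_iff_sub_mem, Ideal.mem_span_singleton]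
  exact hvw i

/-- On the conic, write `minor M i` = s₀ h₀ + s₁ h₁. Modulo this minor, a multiple g s of the line
coordinates is congruent to z (-h₁, h₀). By homogeneity a power of g times P is therefore congruent
to P at (z (-h₁, h₀), x), which is divisible by q according to `conic_dvd_aeval`. -/
lemma exists_mul_eq {δ : ℤ × ℤ} (P : Forms δ) (hP : ∀ y, proj y ∈ c.carrier → val P y = 0)
    (y : Coord) : ∃ (ε : ℤ × ℤ) (D : Forms ε), val D y ≠ 0 ∧
      ∃ b : Fin 3 → Cox, (D * P : Cox) = ∑ i, (minorRow M i : Cox) * b i := by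
  obtain ⟨⟨s, hs⟩, ⟨x, hx⟩⟩ := y
  by_cases hq : evalAt s x (conic M) = 0
  swap
  · exact ⟨_, ⟨conic M, conic_mem⟩, hq, ![P, 0, 0], by rw [sum_minorRow]; simp⟩
  obtain ⟨t, b, ht, rfl, hk⟩ := h.exists_param hq
  have hb : b ≠ 0 := fun hb => hx (by rw [hb, zero_smul])
  -- a row of linear forms that does not vanish at the point
  obtain ⟨i, hi⟩ : ∃ i : Fin 2, ∃ j, evalAt s (b • c.forms.2.value t) (M i.succ j) ≠ 0 := by
    by_contra! hne
    -- If both rows vanish at the point, every t' ≠ 0 is a parameter of it, so all values of g are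
    -- proportional, contrary to their independence.
    have hpar : ∀ t', ∃ b' : ℂ, c.forms.2.value t' = b' • c.forms.2.value t := fun t' => by
      by_cases ht' : t' = 0
      · exact ⟨0, by rw [ht', BinaryForms.value_zero two_ne_zero, zero_smul]⟩
      · obtain ⟨b', hb'⟩ := h.eq_smul s t' (b • c.forms.2.value t) ht'
          (fun i => by simp only [hne, zero_mul, Finset.sum_const_zero])
        have hb0 : b' ≠ 0 := fun h0 => hx (by rw [hb', h0, zero_smul])
        refine ⟨b'⁻¹ * b, ?_⟩
        rw [mul_smul, hb', smul_smul, inv_mul_cancel₀ hb0, one_smul]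
    have hβ : ∀ β : Fin 3 → ℂ, ∑ k, β k * c.forms.2.value t k = 0 → β = 0 := fun β hβ =>
      h.indep β fun t' => by
        obtain ⟨b', hb'⟩ := hpar t'
        rw [hb', ← mul_zero b', ← hβ, Finset.mul_sum]
        exact Finset.sum_congr rfl fun k _ => by simp; ring
    -- Vectors orthogonal to g(t) must be zero; these two contain all three coordinates of g(t) up
    -- to sign.
    have h1 := hβ ![c.forms.2.value t 1, -c.forms.2.value t 0, 0] (by
      simp [Fin.sum_univ_three]; ring)
    have h2 := hβ ![0, c.forms.2.value t 2, -c.forms.2.value t 1] (by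
      simp [Fin.sum_univ_three]; ring)
    refine c.snd_ne t ht (funext fun k => ?_)
    fin_cases k
    · simpa using congrFun h1 1
    · simpa using congrFun h1 0
    · simpa using congrFun h2 1
  obtain ⟨κ, hκ0, hκ1⟩ := eq_smul_of_mul_eq_zero ht (hk i)
  have hκ : κ ≠ 0 := by
    rintro rfl
    obtain ⟨j, hj⟩ := hi
    fin_cases j
    · exact hj (by simpa using hκ0)
    · exact hj (by simpa using hκ1)
  have hm : ∀ s', evalAt s' (b • c.forms.2.value t) (minor M i) =
      κ * b ^ 2 * (s' 0 * c.forms.1.value t 1 - s' 1 * c.forms.1.value t 0) := fun s' =>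
    h.evalAt_minor (by rw [← hκ0]; exact evalAt_congr (lin_mem i 0) _ _ _)
      (by rw [← hκ1]; exact evalAt_congr (lin_mem i 1) _ _ _)
  obtain ⟨h0, h1, hmin, hh0, hh1⟩ := exists_minor_eq (M := M) i
  -- it suffices to work modulo the conic and one of the other minors
  suffices ∃ (g : Forms (0, 3)) (z : Cox), val g (⟨s, hs⟩, ⟨b • c.forms.2.value t, hx⟩) ≠ 0 ∧
      minor M i ∣ (g : Cox) * MvPolynomial.X (.inl 0) + z * (h1 : Cox) ∧
      minor M i ∣ (g : Cox) * MvPolynomial.X (.inl 1) - z * (h0 : Cox) by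
    obtain ⟨g, z, hg, hz0, hz1⟩ := this
    have hpow : (g : Cox) ^ δ.1.toNat ∈ Forms (δ.1.toNat • (0, 3)) :=
      MvPolynomial.IsWeightedHomogeneous.pow g.2 _
    obtain ⟨B, hB⟩ := h.conic_dvd_aeval hP hh0 hh1 z
    have hdvd : minor M i ∣ g ^ δ.1.toNat * P - conic M * B := by
      have e := aeval_smul P.2 (g : Cox) 1 (fun i => MvPolynomial.X (.inl i)) (fun k => MvPolynomial.X (.inr k))
      have e' : (Sum.elim (fun i => MvPolynomial.X (.inl i)) (fun k => MvPolynomial.X (.inr k)) :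
          Fin 2 ⊕ Fin 3 → Cox) = MvPolynomial.X := by ext1 (i | k) <;> rfl
      rw [e', MvPolynomial.aeval_X_left_apply, one_pow, mul_one] at e
      rw [← hB, ← e]
      refine dvd_aeval_sub_aeval _ fun j => ?_
      rcases j with j | k
      · fin_cases j
        · simpa using hz0
        · simpa using hz1
      · simp
    obtain ⟨E, hE⟩ := hdvd
    have hD : (g ^ δ.1.toNat * P : Cox) = conic M * B + minor M i * E := by
      rw [← hE]; ring
    refine ⟨_, ⟨_, hpow⟩, ?_, ?_⟩
    · simp only [val, map_pow] at hg ⊢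
      exact pow_ne_zero _ hg
    · fin_cases i
      · exact ⟨![B, 0, -E], by rw [sum_minorRow]; simpa using hD⟩
      · exact ⟨![B, E, 0], by rw [sum_minorRow]; simpa using hD⟩
  -- At the point, h₀ and h₁ are f₁(t) and -f₀(t) up to the nonzero factor κ b², so one of them can
  -- serve as g. The choices z = s₁ and z = -s₀ make one congruence an equality and the other the
  -- minor itself.
  by_cases hf : c.forms.1.value t 1 = 0
  · refine ⟨h1, -MvPolynomial.X (.inl 0), ?_, ⟨0, by ring⟩, ⟨1, by rw [hmin]; ring⟩⟩
    change evalAt s (b • c.forms.2.value t) h1 ≠ 0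
    rw [hh1, hm]
    have : c.forms.1.value t 0 ≠ 0 := fun h0 => c.fst_ne t ht (funext fun j => by
      fin_cases j <;> assumption)
    simp [hκ, hb, this]
  · refine ⟨h0, MvPolynomial.X (.inl 1), ?_, ⟨1, by rw [hmin]; ring⟩, ⟨0, by ring⟩⟩
    change evalAt s (b • c.forms.2.value t) h0 ≠ 0
    rw [hh0, hm]
    simp [hκ, hb, hf]

/-- If `M` parametrizes a curve then it presents its ideal sheaf. -/
theorem resolves : Resolves M c.carrier :=
  resolves_of_exact M (minorRow M) c.carrier h.val_minorRow minorRow_mul h.eq_zero_of_mul_eq_zero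
    h.exists_eq_mul fun _ P hP => h.exists_mul_eq P hP

end Parametrizes

end resolution

/-! ### Polynomial functions on vector spaces -/

section polyFunctions

variable {V : Type} [AddCommGroup V] [Module ℂ V]

lemma dual_mem_polyFunctions (l : Module.Dual ℂ V) : (fun v => l v) ∈ polyFunctions V :=
  Algebra.subset_adjoin ⟨l, rfl⟩

lemma const_mem_polyFunctions (a : ℂ) : (fun _ => a) ∈ polyFunctions V :=
  (polyFunctions V).algebraMap_mem a

lemma add_mem_polyFunctions {p q : V → ℂ} (hp : p ∈ polyFunctions V) (hq : q ∈ polyFunctions V) :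
    (fun v => p v + q v) ∈ polyFunctions V := add_mem hp hq

lemma mul_mem_polyFunctions {p q : V → ℂ} (hp : p ∈ polyFunctions V) (hq : q ∈ polyFunctions V) :
    (fun v => p v * q v) ∈ polyFunctions V := (polyFunctions V).mul_mem hp hq

lemma sum_mem_polyFunctions {ι : Type} (s : Finset ι) {p : ι → V → ℂ}
    (hp : ∀ i ∈ s, p i ∈ polyFunctions V) : (fun v => ∑ i ∈ s, p i v) ∈ polyFunctions V := by
  have := sum_mem hp
  convert this
  simp

lemma prod_mem_polyFunctions {ι : Type} (s : Finset ι) {p : ι → V → ℂ}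
    (hp : ∀ i ∈ s, p i ∈ polyFunctions V) : (fun v => ∏ i ∈ s, p i v) ∈ polyFunctions V := by
  have := (polyFunctions V).prod_mem hp
  convert this
  simp

lemma det_mem_polyFunctions {ι : Type} [Fintype ι] [DecidableEq ι] {A : V → Matrix ι ι ℂ}
    (hA : ∀ i j, (fun v => A v i j) ∈ polyFunctions V) : (fun v => (A v).det) ∈ polyFunctions V := by
  simp only [Matrix.det_apply']
  exact sum_mem_polyFunctions _ fun σ _ => mul_mem_polyFunctions (const_mem_polyFunctions _)
    (prod_mem_polyFunctions _ fun i _ => hA _ _)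

/-- The restriction of a polynomial function to a line is a polynomial. -/
lemma exists_polynomial_line {p : V → ℂ} (hp : p ∈ polyFunctions V) (v w : V) :
    ∃ P : Polynomial ℂ, ∀ z : ℂ, p (v + z • w) = P.eval z := by
  induction hp using Algebra.adjoin_induction with
  | mem p hp =>
    obtain ⟨l, rfl⟩ := hp
    exact ⟨Polynomial.C (l v) + Polynomial.X * Polynomial.C (l w), fun z => by simp; ring⟩
  | algebraMap a => exact ⟨Polynomial.C a, fun z => by simp⟩
  | add p q _ _ hp hq =>
    obtain ⟨P, hP⟩ := hp
    obtain ⟨Q, hQ⟩ := hq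
    exact ⟨P + Q, fun z => by simp [hP, hQ]⟩
  | mul p q _ _ hp hq =>
    obtain ⟨P, hP⟩ := hp
    obtain ⟨Q, hQ⟩ := hq
    exact ⟨P * Q, fun z => by simp [hP, hQ]⟩

/-- Vector spaces are irreducible in the Zariski topology. -/
lemma exists_ne_zero_and_ne_zero {p q : V → ℂ} (hp : p ∈ polyFunctions V) (hq : q ∈ polyFunctions V)
    {v w : V} (hv : p v ≠ 0) (hw : q w ≠ 0) : ∃ u, p u ≠ 0 ∧ q u ≠ 0 := by
  -- On the line joining v (at 0) and w (at 1) both functions are nonzero univariate polynomials, so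
  -- their product is nonzero too.
  obtain ⟨P, hP⟩ := exists_polynomial_line hp v (w - v)
  obtain ⟨Q, hQ⟩ := exists_polynomial_line hq v (w - v)
  have hP0 : P ≠ 0 := by
    rintro rfl
    exact hv (by simpa using hP 0)
  have hQ0 : Q ≠ 0 := by
    rintro rfl
    exact hw (by simpa using hQ 1)
  by_contra! hne
  refine mul_ne_zero hP0 hQ0 (Polynomial.funext fun z => ?_)
  by_cases h0 : P.eval z = 0
  · simp [h0]
  · rw [← hP] at h0
    simp [← hQ, hne _ h0]

/-- A family of polynomials whose coefficients are polynomial functions of the parameter. -/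
def IsPolyFamily {σ : Type} (Ψ : V → MvPolynomial σ ℂ) : Prop :=
  ∀ μ, (fun v => (Ψ v).coeff μ) ∈ polyFunctions V

namespace IsPolyFamily

variable {σ : Type} {Ψ Θ : V → MvPolynomial σ ℂ}

lemma of_linear (Ψ : V →ₗ[ℂ] MvPolynomial σ ℂ) : IsPolyFamily fun v => Ψ v := fun μ =>
  dual_mem_polyFunctions (MvPolynomial.lcoeff ℂ μ ∘ₗ Ψ)

lemma const (P : MvPolynomial σ ℂ) : IsPolyFamily fun _ : V => P := fun _ =>
  const_mem_polyFunctions _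

lemma C {p : V → ℂ} (hp : p ∈ polyFunctions V) :
    IsPolyFamily fun v => (MvPolynomial.C (p v) : MvPolynomial σ ℂ) := fun μ => by
  classical
  simp only [MvPolynomial.coeff_C]
  split_ifs
  · exact hp
  · exact const_mem_polyFunctions 0

lemma add (hΨ : IsPolyFamily Ψ) (hΘ : IsPolyFamily Θ) : IsPolyFamily fun v => Ψ v + Θ v := fun μ => by
  simpa using add_mem_polyFunctions (hΨ μ) (hΘ μ)

lemma neg (hΨ : IsPolyFamily Ψ) : IsPolyFamily fun v => -Ψ v := fun μ => by
  simpa using mul_mem_polyFunctions (const_mem_polyFunctions (-1)) (hΨ μ)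

lemma sub (hΨ : IsPolyFamily Ψ) (hΘ : IsPolyFamily Θ) : IsPolyFamily fun v => Ψ v - Θ v := by
  simpa only [sub_eq_add_neg] using hΨ.add hΘ.neg

lemma mul (hΨ : IsPolyFamily Ψ) (hΘ : IsPolyFamily Θ) : IsPolyFamily fun v => Ψ v * Θ v := fun μ => by
  classical
  simp only [MvPolynomial.coeff_mul]
  exact sum_mem_polyFunctions _ fun x _ => mul_mem_polyFunctions (hΨ _) (hΘ _)

lemma pow (hΨ : IsPolyFamily Ψ) (n : ℕ) : IsPolyFamily fun v => Ψ v ^ n := by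
  induction n with
  | zero => simpa using const 1
  | succ n ih => simpa only [pow_succ] using ih.mul hΨ

lemma sum {ι : Type} (s : Finset ι) {Ψ : ι → V → MvPolynomial σ ℂ}
    (hΨ : ∀ i ∈ s, IsPolyFamily (Ψ i)) : IsPolyFamily fun v => ∑ i ∈ s, Ψ i v := fun μ => by
  simp only [MvPolynomial.coeff_sum]
  exact sum_mem_polyFunctions _ fun i hi => hΨ i hi μ

/-- Substitution into a family of forms of a fixed bidegree. -/
lemma aeval {d : ℤ × ℤ} {F : V → Cox} (hF : IsPolyFamily F) (hd : ∀ v, F v ∈ Forms d)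
    {s : V → Fin 2 → MvPolynomial σ ℂ} {x : V → Fin 3 → MvPolynomial σ ℂ}
    (hs : ∀ i, IsPolyFamily fun v => s v i) (hx : ∀ k, IsPolyFamily fun v => x v k) :
    IsPolyFamily fun v => MvPolynomial.aeval (Sum.elim (s v) (x v)) (F v) := by
  classical
  -- A bound for all exponents that does not depend on the parameter, so that the sum over monomials
  -- has a fixed index set.
  let b : Fin 2 ⊕ Fin 3 →₀ ℕ := Finsupp.equivFunOnFinite.symm
    (Sum.elim (fun _ => d.1.toNat) (fun _ => d.2.toNat))
  have hsub : ∀ v, (F v).support ⊆ Finset.Icc 0 b := fun v μ hμ => by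
    obtain ⟨h1, h2⟩ := exponents_of_mem (hd v) hμ
    refine Finset.mem_Icc.2 ⟨zero_le, fun i => ?_⟩
    rcases i with i | i
    · change μ (.inl i) ≤ d.1.toNat
      fin_cases i <;> simp <;> omega
    · change μ (.inr i) ≤ d.2.toNat
      fin_cases i <;> simp <;> omega
  have : (fun v => MvPolynomial.aeval (Sum.elim (s v) (x v)) (F v)) = fun v =>
      ∑ μ ∈ Finset.Icc 0 b, MvPolynomial.C ((F v).coeff μ) *
        (s v 0 ^ μ (.inl 0) * s v 1 ^ μ (.inl 1) *
        (x v 0 ^ μ (.inr 0) * x v 1 ^ μ (.inr 1) * x v 2 ^ μ (.inr 2))) := funext fun v => by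
    rw [aeval_eq_sum, MvPolynomial.algebraMap_eq]
    exact Finset.sum_subset (hsub v) fun μ _ hμ => by
      rw [MvPolynomial.notMem_support_iff.1 hμ, map_zero, zero_mul]
  rw [this]
  exact sum _ fun μ _ => (IsPolyFamily.C (hF μ)).mul ((((hs 0).pow _).mul ((hs 1).pow _)).mul
    ((((hx 0).pow _).mul ((hx 1).pow _)).mul ((hx 2).pow _)))

end IsPolyFamily

end polyFunctions

/-! ### Binary forms -/

section binary

/-- The coefficient of `t₀ ^ (n - i) * t₁ ^ i` in a binary form of degree `n`. -/
def binCoeff (n i : ℕ) (P : MvPolynomial (Fin 2) ℂ) : ℂ :=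
  P.coeff (Finsupp.single 0 (n - i) + Finsupp.single 1 i)

lemma monomial_binary (n i : ℕ) (a : ℂ) :
    MvPolynomial.monomial (Finsupp.single (0 : Fin 2) (n - i) + Finsupp.single 1 i) a =
      MvPolynomial.C a * (MvPolynomial.X 0 ^ (n - i) * MvPolynomial.X 1 ^ i) := by
  rw [MvPolynomial.X_pow_eq_monomial, MvPolynomial.X_pow_eq_monomial, MvPolynomial.monomial_mul,
    MvPolynomial.C_mul_monomial, mul_one, mul_one]

lemma isHomogeneous_binary {n i : ℕ} (hi : i ≤ n) : (MvPolynomial.X 0 ^ (n - i) *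
    MvPolynomial.X 1 ^ i : MvPolynomial (Fin 2) ℂ).IsHomogeneous n := by
  have := (MvPolynomial.isHomogeneous_X_pow (R := ℂ) (0 : Fin 2) (n - i)).mul
    (MvPolynomial.isHomogeneous_X_pow (R := ℂ) (1 : Fin 2) i)
  rwa [Nat.sub_add_cancel hi] at this

lemma eq_sum_binCoeff {n : ℕ} {P : MvPolynomial (Fin 2) ℂ} (hP : P.IsHomogeneous n) :
    P = ∑ i ∈ Finset.range (n + 1), MvPolynomial.C (binCoeff n i P) *
      (MvPolynomial.X 0 ^ (n - i) * MvPolynomial.X 1 ^ i) := by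
  classical
  have hsub : P.support ⊆ (Finset.range (n + 1)).image
      fun i => Finsupp.single (0 : Fin 2) (n - i) + Finsupp.single 1 i := fun μ hμ => by
    have h : μ.degree = n := by
      rw [Finsupp.degree_eq_weight_one]
      exact hP (MvPolynomial.mem_support_iff.1 hμ)
    rw [Finsupp.degree_eq_sum, Fin.sum_univ_two] at h
    refine Finset.mem_image.2 ⟨μ 1, Finset.mem_range.2 (by omega), ?_⟩
    ext j
    fin_cases j
    · simp; omega
    · simp
  conv_lhs => rw [P.as_sum]
  rw [Finset.sum_subset hsub fun μ _ hμ => by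
    rw [MvPolynomial.notMem_support_iff.1 hμ, map_zero], Finset.sum_image fun i _ j _ h => by
      simpa using DFunLike.congr_fun h 1]
  exact Finset.sum_congr rfl fun i _ => monomial_binary n i _

lemma eval_eq_sum_binCoeff {n : ℕ} {P : MvPolynomial (Fin 2) ℂ} (hP : P.IsHomogeneous n)
    (t : Fin 2 → ℂ) : MvPolynomial.eval t P =
      ∑ i ∈ Finset.range (n + 1), binCoeff n i P * (t 0 ^ (n - i) * t 1 ^ i) := by
  conv_lhs => rw [eq_sum_binCoeff hP]
  simp

variable {V : Type} [AddCommGroup V] [Module ℂ V]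

/-- A linear form on tuples of binary forms is a linear combination of coefficients. -/
lemma dual_comp_mem_polyFunctions {n k : ℕ} (Ψ : V → BinaryForms n k)
    (hΨ : ∀ i, IsPolyFamily fun v => (Ψ v i).1) (l : Module.Dual ℂ (BinaryForms n k)) :
    (fun v => l (Ψ v)) ∈ polyFunctions V := by
  let E (i : Fin n) (j : Fin (k + 1)) : BinaryForms n k :=
    Pi.single i ⟨_, isHomogeneous_binary (Nat.lt_succ_iff.1 j.2)⟩
  have h : ∀ f : BinaryForms n k, f = ∑ i, ∑ j : Fin (k + 1), binCoeff k j (f i).1 • E i j := fun f => by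
    refine funext fun i => Subtype.ext ?_
    have h1 := eq_sum_binCoeff (f i).2
    rw [← Fin.sum_univ_eq_sum_range (fun j => MvPolynomial.C (binCoeff k j (f i).1) *
      (MvPolynomial.X 0 ^ (k - j) * MvPolynomial.X 1 ^ j))] at h1
    refine h1.trans ?_
    rw [Finset.sum_apply, Finset.sum_eq_single i (fun i' _ hi' => ?_) (by simp)]
    · simp [E, MvPolynomial.C_mul']
    · simp [E, hi'.symm]
  have h2 : (fun v => l (Ψ v)) = fun v => ∑ i, ∑ j : Fin (k + 1),
      binCoeff k j (Ψ v i).1 * l (E i j) := funext fun v => by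
    conv_lhs => rw [h (Ψ v)]
    simp
  rw [h2]
  exact sum_mem_polyFunctions _ fun i _ => sum_mem_polyFunctions _ fun j _ =>
    mul_mem_polyFunctions (hΨ i _) (const_mem_polyFunctions _)

/-- The Sylvester matrix of a pair of binary quintics. -/
def sylvester (f : BinaryForms 2 5) : Matrix (Fin 2 × Fin 5) (Fin 2 × Fin 5) ℂ :=
  Matrix.of fun a b => binCoeff 9 (5 * b.1 + b.2)
    (MvPolynomial.X 0 ^ (4 - a.2.1) * MvPolynomial.X 1 ^ a.2.1 * (f a.1).1)

/-- Applied to the vector of monomials of degree 9 at t, the matrix returns the values at t of the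
multiples of f₀ and f₁ by quartic monomials. At a common zero all of these vanish, hence so do the
monomials. -/
lemma value_ne_zero_of_sylvester {f : BinaryForms 2 5} (hf : (sylvester f).det ≠ 0)
    (t : Fin 2 → ℂ) (ht : t ≠ 0) : f.value t ≠ 0 := by
  intro h0
  have hv : (sylvester f).mulVec (fun b => t 0 ^ (9 - (5 * b.1 + b.2 : ℕ)) * t 1 ^ (5 * b.1 + b.2 : ℕ)) = 0 := by
    funext a
    have hh : (MvPolynomial.X 0 ^ (4 - a.2.1) * MvPolynomial.X 1 ^ a.2.1 * (f a.1).1 :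
        MvPolynomial (Fin 2) ℂ).IsHomogeneous 9 :=
      (isHomogeneous_binary (by omega)).mul (f a.1).2
    have h1 := eval_eq_sum_binCoeff hh t
    have h2 : MvPolynomial.eval t (f a.1).1 = 0 := congrFun h0 a.1
    rw [map_mul, h2, mul_zero] at h1
    rw [Matrix.mulVec, dotProduct, Fintype.sum_prod_type, Fin.sum_univ_two, Fin.sum_univ_five,
      Fin.sum_univ_five]
    simp only [Finset.sum_range_succ, Finset.sum_range_zero] at h1
    simp only [sylvester, Matrix.of_apply, Pi.zero_apply]
    rw [h1]
    simp
    ring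
  have := congrFun (Matrix.eq_zero_of_mulVec_eq_zero hf hv)
  -- The extreme monomials t₀⁹ and t₁⁹.
  have h0 := this (0, 0)
  have h1 := this (1, 4)
  simp at h0 h1
  exact ht (funext fun j => by fin_cases j <;> assumption)

end binary

/-! ### The curve of a matrix -/

section curve

/-- The matrix of the coefficients of a triple of binary quadrics. -/
def gram (g : BinaryForms 3 2) : Matrix (Fin 3) (Fin 3) ℂ :=
  Matrix.of fun k i => binCoeff 2 i (g k).1

lemma value_eq_gram (g : BinaryForms 3 2) (t : Fin 2 → ℂ) (k : Fin 3) :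
    g.value t k = gram g k 0 * t 0 ^ 2 + gram g k 1 * (t 0 * t 1) + gram g k 2 * t 1 ^ 2 := by
  refine (eval_eq_sum_binCoeff (g k).2 t).trans ?_
  simp [Finset.sum_range_succ, gram]

lemma value_ne_zero_of_gram {g : BinaryForms 3 2} (hg : (gram g).det ≠ 0) (t : Fin 2 → ℂ)
    (ht : t ≠ 0) : g.value t ≠ 0 := by
  intro h0
  have := congrFun (Matrix.eq_zero_of_mulVec_eq_zero (v := ![t 0 ^ 2, t 0 * t 1, t 1 ^ 2]) hg (by
    funext k
    rw [Matrix.mulVec, dotProduct, Fin.sum_univ_three]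
    exact (value_eq_gram g t k).symm.trans (congrFun h0 k)))
  have h0 := this 0
  have h2 := this 2
  simp at h0 h2
  exact ht (funext fun j => by fin_cases j <;> assumption)

variable (M : FormMatrix syzDeg genDeg)

/-- The coefficient of the `k`-th coordinate of the plane in the entry of the lower two rows of `M`
with indices `i + 1` and `j`. -/
def linCoeff (i j : Fin 2) (k : Fin 3) : ℂ := evalAt 0 (Pi.single k 1) (M i.succ j)

/-- The product of the row with index `i + 1` with the vector `t`, as a linear form on the plane. -/
def rowForm (i : Fin 2) (k : Fin 3) : MvPolynomial (Fin 2) ℂ :=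
  ∑ j, MvPolynomial.C (linCoeff M i j k) * MvPolynomial.X j

/-- The parametrization of the conic: the product of the lower two rows of `M` with `t` is a pair
of linear forms on the plane, with one common zero. -/
def planeForms : Fin 3 → MvPolynomial (Fin 2) ℂ := crossProduct (rowForm M 0) (rowForm M 1)

/-- The product of the first row of `M` with `t` at the point of the conic with the parameter `t`,
for fixed coordinates of the line. -/
def lineForm (v : Fin 2 → ℂ) : MvPolynomial (Fin 2) ℂ :=
  ∑ j, MvPolynomial.X j *
    MvPolynomial.aeval (Sum.elim (fun i => MvPolynomial.C (v i)) (planeForms M)) (M 0 j : Cox)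

lemma isHomogeneous_rowForm (i : Fin 2) (k : Fin 3) : (rowForm M i k).IsHomogeneous 1 :=
  MvPolynomial.IsHomogeneous.sum _ _ _ fun j _ => by
    have := (MvPolynomial.isHomogeneous_C (Fin 2) (linCoeff M i j k)).mul
      (MvPolynomial.isHomogeneous_X ℂ j)
    rwa [zero_add] at this

lemma isHomogeneous_planeForms (k : Fin 3) : (planeForms M k).IsHomogeneous 2 := by
  have h := fun a b => (isHomogeneous_rowForm M 0 a).mul (isHomogeneous_rowForm M 1 b)
  rw [planeForms, cross_apply]
  fin_cases k
  · exact (h 1 2).sub (h 2 1)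
  · exact (h 2 0).sub (h 0 2)
  · exact (h 0 1).sub (h 1 0)

/-- The degree is 1 from the factor t plus 2 · 2 from substituting quadrics into forms of degree 2
in x. -/
lemma isHomogeneous_lineForm (v : Fin 2 → ℂ) : (lineForm M v).IsHomogeneous 5 :=
  MvPolynomial.IsHomogeneous.sum _ _ _ fun j _ => by
    refine (MvPolynomial.isHomogeneous_X ℂ j).mul (n := 4) ?_
    rw [aeval_eq_sum]
    refine MvPolynomial.IsHomogeneous.sum _ _ _ fun μ hμ => ?_
    obtain ⟨-, h2⟩ := exponents_of_mem (top_mem j) hμ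
    simp only at h2
    have h := fun k => (isHomogeneous_planeForms M k).pow (μ (.inr k))
    have := (MvPolynomial.isHomogeneous_C (Fin 2) (MvPolynomial.coeff μ (M 0 j : Cox) *
      (v 0 ^ μ (.inl 0) * v 1 ^ μ (.inl 1)))).mul (((h 0).mul (h 1)).mul (h 2))
    rw [show 0 + (2 * μ (.inr 0) + 2 * μ (.inr 1) + 2 * μ (.inr 2)) = 4 by omega] at this
    simpa only [MvPolynomial.algebraMap_eq, map_mul, map_pow, mul_assoc] using this

/-- The forms that define the parametrization of the curve of a matrix. -/
def curveForms : BinaryForms 2 5 × BinaryForms 3 2 :=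
  -- The sign and the order of the components make the contracted first row equal to s₀ f₁ - s₁ f₀.
  (Fin.cons ⟨-lineForm M ![0, 1], (isHomogeneous_lineForm M _).neg⟩
    (Fin.cons ⟨lineForm M ![1, 0], isHomogeneous_lineForm M _⟩ finZeroElim),
   fun k => ⟨planeForms M k, isHomogeneous_planeForms M k⟩)

variable {M}

lemma eval_rowForm (i : Fin 2) (k : Fin 3) (t : Fin 2 → ℂ) :
    MvPolynomial.eval t (rowForm M i k) = linCoeff M i 0 k * t 0 + linCoeff M i 1 k * t 1 := by
  simp [rowForm]

lemma value_curveForms_snd (t : Fin 2 → ℂ) : (curveForms M).2.value t =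
    crossProduct (fun k => MvPolynomial.eval t (rowForm M 0 k))
      (fun k => MvPolynomial.eval t (rowForm M 1 k)) := by
  funext k
  change MvPolynomial.eval t (planeForms M k) = _
  rw [planeForms, cross_apply, cross_apply]
  fin_cases k <;> simp

lemma eval_lineForm (v t : Fin 2 → ℂ) : MvPolynomial.eval t (lineForm M v) =
    ∑ j, evalAt v ((curveForms M).2.value t) (M 0 j) * t j := by
  simp only [lineForm, map_sum, map_mul]
  refine Finset.sum_congr rfl fun j _ => ?_
  rw [MvPolynomial.eval_X, mul_comm]
  congr 1
  rw [← MvPolynomial.aeval_eq_eval, MvPolynomial.comp_aeval_apply, evalAt,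
    ← MvPolynomial.aeval_eq_eval]
  congr 2
  ext (i | k)
  · simp
  · simp [MvPolynomial.aeval_eq_eval, BinaryForms.value, curveForms]

lemma evalAt_lin (s : Fin 2 → ℂ) (x : Fin 3 → ℂ) (i j : Fin 2) :
    evalAt s x (M i.succ j) = ∑ k, linCoeff M i j k * x k :=
  evalAt_of_snd_eq_one (lin_mem i j) s x

lemma sum_evalAt_lin (s t : Fin 2 → ℂ) (x : Fin 3 → ℂ) (i : Fin 2) :
    ∑ j, evalAt s x (M i.succ j) * t j = ∑ k, MvPolynomial.eval t (rowForm M i k) * x k := by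
  simp only [evalAt_lin, eval_rowForm, Fin.sum_univ_two, Fin.sum_univ_three]
  ring

/-- The cross product is bilinear in the two rows; comparing values at (1, 0), (0, 1) and (1, 1)
isolates the three coefficients. -/
lemma gram_curveForms (k : Fin 3) :
    gram (curveForms M).2 k 0 = crossProduct (linCoeff M 0 0) (linCoeff M 1 0) k ∧
    gram (curveForms M).2 k 1 = crossProduct (linCoeff M 0 0) (linCoeff M 1 1) k +
      crossProduct (linCoeff M 0 1) (linCoeff M 1 0) k ∧
    gram (curveForms M).2 k 2 = crossProduct (linCoeff M 0 1) (linCoeff M 1 1) k := by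
  have h := fun t => (value_eq_gram (curveForms M).2 t k).symm.trans
    (congrFun (value_curveForms_snd t) k)
  simp only [cross_apply, eval_rowForm] at h ⊢
  have h0 := h ![1, 0]
  have h1 := h ![0, 1]
  have h2 := h ![1, 1]
  fin_cases k <;>
  · simp at h0 h1 h2 ⊢
    refine ⟨h0, ?_, h1⟩
    linear_combination h2 - h0 - h1

/-- The determinant of the coefficients of the parametrization is the discriminant of the conic. -/
lemma conic_ne_zero_of_gram (hM : (gram (curveForms M).2).det ≠ 0) : conic M ≠ 0 := by
  intro h0
  apply hM
  have hq : ∀ x : Fin 3 → ℂ, (∑ k, linCoeff M 0 0 k * x k) * (∑ k, linCoeff M 1 1 k * x k) -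
      (∑ k, linCoeff M 0 1 k * x k) * (∑ k, linCoeff M 1 0 k * x k) = 0 := fun x => by
    have := congrArg (evalAt 0 x) h0
    rw [conic, map_sub, map_mul, map_mul, map_zero] at this
    rwa [← evalAt_lin 0, ← evalAt_lin 0, ← evalAt_lin 0, ← evalAt_lin 0]
  -- Unit vectors and sums of two of them determine the six coefficients of the conic.
  have h00 := hq ![1, 0, 0]
  have h11 := hq ![0, 1, 0]
  have h22 := hq ![0, 0, 1]
  have h01 := hq ![1, 1, 0]
  have h02 := hq ![1, 0, 1]
  have h12 := hq ![0, 1, 1]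
  simp [Fin.sum_univ_three] at h00 h11 h22 h01 h02 h12
  rw [Matrix.det_fin_three]
  simp only [(gram_curveForms _).1, (gram_curveForms _).2.1, (gram_curveForms _).2.2, cross_apply]
  simp only [Matrix.cons_val_zero, Matrix.cons_val_one, Matrix.cons_val]
  generalize linCoeff M 0 0 = a at *
  generalize linCoeff M 0 1 = b at *
  generalize linCoeff M 1 0 = c at *
  generalize linCoeff M 1 1 = d at *
  have e01 : a 0 * d 1 + a 1 * d 0 - b 0 * c 1 - b 1 * c 0 = 0 := by
    linear_combination h01 - h00 - h11
  have e02 : a 0 * d 2 + a 2 * d 0 - b 0 * c 2 - b 2 * c 0 = 0 := by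
    linear_combination h02 - h00 - h22
  have e12 : a 1 * d 2 + a 2 * d 1 - b 1 * c 2 - b 2 * c 1 = 0 := by
    linear_combination h12 - h11 - h22
  -- With q_{ij} for the coefficients of the conic, the determinant equals 4 q₀₀ q₁₁ q₂₂ + q₀₁ q₀₂
  -- q₁₂ - q₀₀ q₁₂² - q₁₁ q₀₂² - q₂₂ q₀₁².
  linear_combination (4 * (a 1 * d 1 - b 1 * c 1) * (a 2 * d 2 - b 2 * c 2)) * h00 +
    ((a 0 * d 2 + a 2 * d 0 - b 0 * c 2 - b 2 * c 0) *
      (a 1 * d 2 + a 2 * d 1 - b 1 * c 2 - b 2 * c 1) -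
      (a 2 * d 2 - b 2 * c 2) * (a 0 * d 1 + a 1 * d 0 - b 0 * c 1 - b 1 * c 0)) * e01 -
    (a 1 * d 1 - b 1 * c 1) * (a 0 * d 2 + a 2 * d 0 - b 0 * c 2 - b 2 * c 0) * e02 -
    (a 0 * d 0 - b 0 * c 0) * (a 1 * d 2 + a 2 * d 1 - b 1 * c 2 - b 2 * c 1) * e12

/-- Since x is orthogonal to u and v, its cross product with u × v vanishes; the three identities in
the proof are the components of this. -/
lemma eq_smul_cross {u v x : Fin 3 → ℂ} (hu : ∑ k, u k * x k = 0) (hv : ∑ k, v k * x k = 0)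
    (hne : crossProduct u v ≠ 0) : ∃ b : ℂ, x = b • crossProduct u v := by
  obtain ⟨k, hk⟩ := Function.ne_iff.1 hne
  rw [Pi.zero_apply] at hk
  refine ⟨x k / crossProduct u v k, funext fun j => ?_⟩
  rw [Pi.smul_apply, smul_eq_mul, div_mul_eq_mul_div, eq_div_iff hk]
  rw [cross_apply]
  rw [Fin.sum_univ_three] at hu hv
  have h01 : (u 1 * v 2 - u 2 * v 1) * x 1 = (u 2 * v 0 - u 0 * v 2) * x 0 := by
    linear_combination v 2 * hu - u 2 * hv
  have h12 : (u 2 * v 0 - u 0 * v 2) * x 2 = (u 0 * v 1 - u 1 * v 0) * x 1 := by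
    linear_combination v 0 * hu - u 0 * hv
  have h20 : (u 0 * v 1 - u 1 * v 0) * x 0 = (u 1 * v 2 - u 2 * v 1) * x 2 := by
    linear_combination v 1 * hu - u 1 * hv
  fin_cases k <;> fin_cases j <;> simp <;> grind

/-- A matrix parametrizes its curve if the conic is nondegenerate. -/
theorem parametrizes_of_gram (c : RationalCurve 5 2) (hc : c.forms = curveForms M)
    (hM : (gram c.forms.2).det ≠ 0) : Parametrizes M c where
  lin_mul s t i := by
    rw [sum_evalAt_lin, hc, value_curveForms_snd, cross_apply]
    fin_cases i <;> simp [Fin.sum_univ_three] <;> ring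
  eq_smul s t x ht h := by
    have h0 := h 0
    have h1 := h 1
    have hne := c.snd_ne t ht
    rw [sum_evalAt_lin] at h0 h1
    rw [hc, value_curveForms_snd] at hne ⊢
    exact eq_smul_cross h0 h1 hne
  top_mul s t := by
    have h1 : c.forms.1.value t 1 = MvPolynomial.eval t (lineForm M ![1, 0]) := by rw [hc]; rfl
    have h0 : c.forms.1.value t 0 = -MvPolynomial.eval t (lineForm M ![0, 1]) := by
      rw [hc, ← map_neg]; rfl
    rw [h0, h1, eval_lineForm, eval_lineForm, hc, Fin.sum_univ_two, Fin.sum_univ_two,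
      Fin.sum_univ_two, evalAt_of_fst_eq_one (top_mem 0), evalAt_of_fst_eq_one (top_mem 1) s]
    ring
  indep β hβ := by
    have hv : Matrix.vecMul β (gram c.forms.2) = 0 := by
      simp only [value_eq_gram, Fin.sum_univ_three] at hβ
      have h0 := hβ ![1, 0]
      have h1 := hβ ![0, 1]
      have h2 := hβ ![1, 1]
      simp at h0 h1 h2
      funext i
      rw [Matrix.vecMul, dotProduct, Fin.sum_univ_three, Pi.zero_apply]
      fin_cases i
      · exact h0
      · change β 0 * gram c.forms.2 0 1 + β 1 * gram c.forms.2 1 1 + β 2 * gram c.forms.2 2 1 = 0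
        linear_combination h2 - h0 - h1
      · exact h1
    exact Matrix.eq_zero_of_vecMul_eq_zero hM hv
  conic_ne_zero := conic_ne_zero_of_gram (by rwa [← hc])

end curve

section generic

/-! ### Every nondegenerate curve is the curve of a matrix -/

lemma exists_formMatrix (a : Fin 2 → Forms (1, 2)) (l : Fin 2 → Fin 2 → Forms (0, 1)) :
    ∃ M : FormMatrix syzDeg genDeg, (∀ j, (M 0 j : Cox) = a j) ∧
      ∀ i j, (M i.succ j : Cox) = l i j := by
  have h0 : ∀ j, genDeg 0 - syzDeg j = (1, 2) := fun j => by fin_cases j <;> rfl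
  have h1 : ∀ i j : Fin 2, genDeg i.succ - syzDeg j = (0, 1) := fun i j => by
    fin_cases i <;> fin_cases j <;> rfl
  exact ⟨Fin.cons (fun j => ⟨a j, (h0 j).symm ▸ (a j).2⟩)
    (fun i j => ⟨l i j, (h1 i j).symm ▸ (l i j).2⟩), fun j => rfl, fun i j => rfl⟩

/-- The linear form on the plane with given coefficients. -/
def planeLinear (y : Fin 3 → ℂ) : Cox := ∑ k, MvPolynomial.C (y k) * MvPolynomial.X (.inr k)

lemma planeLinear_mem (y : Fin 3 → ℂ) : planeLinear y ∈ Forms (0, 1) :=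
  Submodule.sum_mem _ fun k _ => MvPolynomial.IsWeightedHomogeneous.C_mul
    (MvPolynomial.isWeightedHomogeneous_X ℂ bideg (.inr k)) _

lemma evalAt_planeLinear (s : Fin 2 → ℂ) (x y : Fin 3 → ℂ) :
    evalAt s x (planeLinear y) = ∑ k, y k * x k := by
  simp [planeLinear]

/-- A combination of products of linear forms that has bidegree `(1, 2)`. -/
lemma line_mul_mem (y z : Fin 3 → ℂ) (a : ℂ) (i : Fin 2) :
    MvPolynomial.X (.inl i) * (MvPolynomial.C a * (planeLinear y * planeLinear z)) ∈
      Forms (1, 2) :=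
  mul_mem (MvPolynomial.isWeightedHomogeneous_X ℂ bideg (.inl i))
    (MvPolynomial.IsWeightedHomogeneous.C_mul (mul_mem (planeLinear_mem y) (planeLinear_mem z)) a)

lemma BinaryForms.ext_value {n k : ℕ} {f g : BinaryForms n k} (h : ∀ t, f.value t = g.value t) :
    f = g :=
  funext fun i => Subtype.ext (MvPolynomial.funext fun t => congrFun (h t) i)

/-- Independence of the gₖ provides linear forms Y₀, Y₁, Y₂ on the plane that restrict to t₀², t₀t₁,
t₁² on the conic. The lower rows are the syzygies Y₁ t₀ - Y₀ t₁ and Y₂ t₀ - Y₁ t₁. The first row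
exists because every quintic is t₀ times a quartic plus a multiple of t₁⁵, and quartics in t are
quadratic in the Yᵢ. -/
theorem exists_curveForms_eq (f : BinaryForms 2 5) (g : BinaryForms 3 2)
    (hg : (gram g).det ≠ 0) : ∃ M, curveForms M = (f, g) := by
  let G : Fin 3 → Fin 3 → ℂ := fun i k => gram g k i
  let Δ := (gram g).det
  -- The rows of the inverse of `gram g`, by Cramer's rule.
  let Y : Fin 3 → Fin 3 → ℂ :=
    ![Δ⁻¹ • crossProduct (G 1) (G 2), Δ⁻¹ • crossProduct (G 2) (G 0), Δ⁻¹ • crossProduct (G 0) (G 1)]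
  have hΔ : Δ = gram g 0 0 * gram g 1 1 * gram g 2 2 - gram g 0 0 * gram g 1 2 * gram g 2 1 -
      gram g 0 1 * gram g 1 0 * gram g 2 2 + gram g 0 1 * gram g 1 2 * gram g 2 0 +
      gram g 0 2 * gram g 1 0 * gram g 2 1 - gram g 0 2 * gram g 1 1 * gram g 2 0 :=
    Matrix.det_fin_three _
  have hΔ0 : Δ ≠ 0 := hg
  have hY : ∀ t, ∑ k, Y 0 k * g.value t k = t 0 ^ 2 ∧ ∑ k, Y 1 k * g.value t k = t 0 * t 1 ∧
      ∑ k, Y 2 k * g.value t k = t 1 ^ 2 := fun t => by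
    simp only [Fin.sum_univ_three, value_eq_gram, Y, cross_apply, G]
    simp
    refine ⟨?_, ?_, ?_⟩ <;>
    · field_simp
      rw [hΔ]
      ring
  let φ : ℕ → ℂ := fun i => binCoeff 5 i (f 1).1
  let ψ : ℕ → ℂ := fun i => binCoeff 5 i (f 0).1
  let S (a : ℂ) (i : Fin 2) (y z : Fin 3) : Cox :=
    MvPolynomial.X (.inl i) * (MvPolynomial.C a * (planeLinear (Y y) * planeLinear (Y z)))
  have hS : ∀ a i y z, S a i y z ∈ Forms (1, 2) := fun a i y z => line_mul_mem _ _ a i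
  let a : Fin 2 → Forms (1, 2) := ![
    ⟨S (φ 0) 0 0 0 + S (φ 1) 0 0 1 + S (φ 2) 0 1 1 + S (φ 3) 0 1 2 + S (φ 4) 0 2 2 -
      (S (ψ 0) 1 0 0 + S (ψ 1) 1 0 1 + S (ψ 2) 1 1 1 + S (ψ 3) 1 1 2 + S (ψ 4) 1 2 2),
      sub_mem (add_mem (add_mem (add_mem (add_mem (hS _ _ _ _) (hS _ _ _ _)) (hS _ _ _ _))
        (hS _ _ _ _)) (hS _ _ _ _)) (add_mem (add_mem (add_mem (add_mem (hS _ _ _ _)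
        (hS _ _ _ _)) (hS _ _ _ _)) (hS _ _ _ _)) (hS _ _ _ _))⟩,
    ⟨S (φ 5) 0 2 2 - S (ψ 5) 1 2 2, sub_mem (hS _ _ _ _) (hS _ _ _ _)⟩]
  -- The factor Δ normalizes the parametrization: the cross product of two vectors of the dual basis
  -- is Δ⁻¹ times a vector of the original one.
  let L : Fin 2 → Fin 2 → Fin 3 → ℂ := ![![Y 1, -Y 0], ![Δ • Y 2, -(Δ • Y 1)]]
  obtain ⟨M, hM0, hM1⟩ := exists_formMatrix a fun i j => ⟨planeLinear (L i j), planeLinear_mem _⟩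
  refine ⟨M, ?_⟩
  have hL : ∀ i j, linCoeff M i j = L i j := fun i j => funext fun k => by
    rw [linCoeff, hM1, evalAt_planeLinear]
    simp [Pi.single_apply]
  have hsnd : (curveForms M).2 = g := BinaryForms.ext_value fun t => funext fun k => by
    obtain ⟨h0, h1, h2⟩ := gram_curveForms (M := M) k
    simp only [hL] at h0 h1 h2
    have e0 : crossProduct (L 0 0) (L 1 0) k = gram g k 0 := by
      simp only [L, Y, cross_apply, G]
      fin_cases k <;>
      · simp
        field_simp
        rw [hΔ]
        ring
    have e1 : crossProduct (L 0 0) (L 1 1) k + crossProduct (L 0 1) (L 1 0) k = gram g k 1 := by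
      simp only [L, Y, cross_apply, G]
      fin_cases k <;>
      · simp
        field_simp
        rw [hΔ]
        ring
    have e2 : crossProduct (L 0 1) (L 1 1) k = gram g k 2 := by
      simp only [L, Y, cross_apply, G]
      fin_cases k <;>
      · simp
        field_simp
        rw [hΔ]
        ring
    rw [value_eq_gram, value_eq_gram, h0, h1, h2, e0, e1, e2]
  refine Prod.ext (BinaryForms.ext_value fun t => funext fun i => ?_) hsnd
  have hl := fun v => eval_lineForm (M := M) v t
  obtain ⟨hY0, hY1, hY2⟩ := hY t
  simp only [hsnd, Fin.sum_univ_two, hM0] at hl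
  have hf := fun i => eval_eq_sum_binCoeff (f i).2 t
  simp only [Finset.sum_range_succ, Finset.sum_range_zero] at hf
  have hSv : ∀ v c i y z, evalAt v (g.value t) (S c i y z) = v i * (c * ((∑ k, Y y k * g.value t k) *
      ∑ k, Y z k * g.value t k)) := fun v c i y z => by
    simp only [S, map_mul, evalAt_planeLinear]
    simp
  fin_cases i
  · change MvPolynomial.eval t (-lineForm M ![0, 1]) = MvPolynomial.eval t (f 0).1
    rw [map_neg, hl, hf]
    simp [a, hSv, hY0, hY1, hY2, ψ]
    ring
  · change MvPolynomial.eval t (lineForm M ![1, 0]) = MvPolynomial.eval t (f 1).1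
    rw [hl, hf]
    simp [a, hSv, hY0, hY1, hY2, φ]
    ring

/-! ### The curve of a matrix depends polynomially on the matrix -/

/-- The entry of a matrix as a linear map. -/
def entryLinear (i : Fin 3) (j : Fin 2) : FormMatrix syzDeg genDeg →ₗ[ℂ] Cox where
  toFun M := M i j
  map_add' _ _ := rfl
  map_smul' _ _ := rfl

lemma isPolyFamily_entry (i : Fin 3) (j : Fin 2) :
    IsPolyFamily fun M : FormMatrix syzDeg genDeg => (M i j : Cox) :=
  IsPolyFamily.of_linear (entryLinear i j)

lemma linCoeff_mem_polyFunctions (i j : Fin 2) (k : Fin 3) :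
    (fun M => linCoeff M i j k) ∈ polyFunctions (FormMatrix syzDeg genDeg) := by
  have h : ∀ M, linCoeff M i j k = ((MvPolynomial.aeval (R := ℂ)
      (Sum.elim (0 : Fin 2 → ℂ) (Pi.single k 1))).toLinearMap ∘ₗ entryLinear i.succ j) M := fun M => by
    change _ = MvPolynomial.aeval (Sum.elim (0 : Fin 2 → ℂ) (Pi.single k 1)) (M i.succ j : Cox)
    rw [MvPolynomial.aeval_eq_eval]
    rfl
  simp only [h]
  exact dual_mem_polyFunctions _

lemma isPolyFamily_planeForms (k : Fin 3) : IsPolyFamily fun M => planeForms M k := by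
  have h : ∀ i k, IsPolyFamily fun M => rowForm M i k := fun i k =>
    IsPolyFamily.sum _ fun j _ => (IsPolyFamily.C (linCoeff_mem_polyFunctions i j k)).mul (.const _)
  simp only [planeForms, cross_apply]
  fin_cases k
  · exact ((h 0 1).mul (h 1 2)).sub ((h 0 2).mul (h 1 1))
  · exact ((h 0 2).mul (h 1 0)).sub ((h 0 0).mul (h 1 2))
  · exact ((h 0 0).mul (h 1 1)).sub ((h 0 1).mul (h 1 0))

lemma isPolyFamily_lineForm (v : Fin 2 → ℂ) : IsPolyFamily fun M => lineForm M v :=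
  IsPolyFamily.sum _ fun j _ => (IsPolyFamily.const _).mul
    ((isPolyFamily_entry 0 j).aeval (fun _ => top_mem j) (fun _ => .const _)
      isPolyFamily_planeForms)

/-- Polynomial functions are generated by linear forms, and the latter are combinations of the
coefficients of the forms, which are polynomial in the entries of M. -/
lemma comp_curveForms_mem_polyFunctions {h : BinaryForms 2 5 × BinaryForms 3 2 → ℂ}
    (hh : h ∈ polyFunctions _) :
    (fun M => h (curveForms M)) ∈ polyFunctions (FormMatrix syzDeg genDeg) := by
  induction hh using Algebra.adjoin_induction with
  | mem p hp =>
    obtain ⟨l, rfl⟩ := hp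
    have h1 := dual_comp_mem_polyFunctions (fun M => (curveForms M).1) (fun i => by
      fin_cases i
      · exact (isPolyFamily_lineForm ![0, 1]).neg
      · exact isPolyFamily_lineForm ![1, 0]) (l ∘ₗ LinearMap.inl ℂ _ _)
    have h2 := dual_comp_mem_polyFunctions (fun M => (curveForms M).2) isPolyFamily_planeForms
      (l ∘ₗ LinearMap.inr ℂ _ _)
    convert add_mem_polyFunctions h1 h2 using 2 with M
    simp [← map_add]
  | algebraMap a => exact const_mem_polyFunctions a
  | add p q _ _ hp hq => exact add_mem_polyFunctions hp hq
  | mul p q _ _ hp hq => exact mul_mem_polyFunctions hp hq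

/-! ### Generic curves -/

lemma gram_det_mem_polyFunctions :
    (fun v => (gram v.2).det) ∈ polyFunctions (BinaryForms 2 5 × BinaryForms 3 2) := by
  have h : ∀ k, IsPolyFamily fun v : BinaryForms 2 5 × BinaryForms 3 2 => (v.2 k).1 := fun k =>
    IsPolyFamily.of_linear
      { toFun := fun v : BinaryForms 2 5 × BinaryForms 3 2 => (v.2 k).1, map_add' := fun _ _ => rfl, map_smul' := fun _ _ => rfl }
  exact det_mem_polyFunctions fun k i => h k _

lemma sylvester_det_mem_polyFunctions :
    (fun v => (sylvester v.1).det) ∈ polyFunctions (BinaryForms 2 5 × BinaryForms 3 2) := by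
  have h : ∀ k, IsPolyFamily fun v : BinaryForms 2 5 × BinaryForms 3 2 => (v.1 k).1 := fun k =>
    IsPolyFamily.of_linear
      { toFun := fun v : BinaryForms 2 5 × BinaryForms 3 2 => (v.1 k).1, map_add' := fun _ _ => rfl, map_smul' := fun _ _ => rfl }
  exact det_mem_polyFunctions fun a _ => ((IsPolyFamily.const _).mul (h a.1)) _

lemma binCoeff_binary (n i j : ℕ) :
    binCoeff n i (MvPolynomial.X 0 ^ (n - j) * MvPolynomial.X 1 ^ j) = if i = j then 1 else 0 := by
  classical
  have := monomial_binary n j 1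
  rw [MvPolynomial.C_1, one_mul] at this
  rw [binCoeff, ← this, MvPolynomial.coeff_monomial]
  refine if_congr ⟨fun h => ?_, fun h => by rw [h]⟩ rfl rfl
  simpa using (DFunLike.congr_fun h 1).symm

lemma exists_gram_det_ne_zero :
    ∃ v : BinaryForms 2 5 × BinaryForms 3 2, (gram v.2).det ≠ 0 := by
  -- The quadrics t₀², t₀t₁, t₁² have the identity as coefficient matrix.
  refine ⟨(0, fun k => ⟨_, isHomogeneous_binary (Nat.lt_succ_iff.1 k.2)⟩), ?_⟩
  have : gram (fun k => ⟨_, isHomogeneous_binary (Nat.lt_succ_iff.1 k.2)⟩) = 1 := by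
    ext k i
    rw [gram, Matrix.of_apply, binCoeff_binary, Matrix.one_apply]
    simp [Fin.ext_iff, eq_comm]
  rw [this, Matrix.det_one]
  exact one_ne_zero

lemma exists_sylvester_det_ne_zero :
    ∃ v : BinaryForms 2 5 × BinaryForms 3 2, (sylvester v.1).det ≠ 0 := by
  -- For the pair t₀⁵, t₁⁵ the Sylvester matrix is the identity.
  let f : BinaryForms 2 5 := fun e => ⟨_, isHomogeneous_binary (n := 5) (i := 5 * e) (by omega)⟩
  refine ⟨(f, 0), ?_⟩
  have : sylvester f = 1 := by
    ext a b
    have h : (MvPolynomial.X 0 ^ (4 - a.2.1) * MvPolynomial.X 1 ^ a.2.1 * (f a.1).1 :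
        MvPolynomial (Fin 2) ℂ) = MvPolynomial.X 0 ^ (9 - (5 * a.1.1 + a.2.1)) *
        MvPolynomial.X 1 ^ (5 * a.1.1 + a.2.1) := by
      rw [show 9 - (5 * a.1.1 + a.2.1) = (4 - a.2.1) + (5 - 5 * a.1.1) by omega]
      simp only [f]
      ring
    rw [sylvester, Matrix.of_apply, h, binCoeff_binary, Matrix.one_apply]
    refine if_congr ⟨fun h => ?_, fun h => by rw [h]⟩ rfl rfl
    ext <;> omega
  rw [this, Matrix.det_one]
  exact one_ne_zero

/-- An open set of curves contains the nonvanishing locus of a polynomial function. -/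
lemma exists_polyFunction {a b : ℕ} {U : Set (RationalCurve a b)} (hU : IsOpen U)
    {c : RationalCurve a b} (hc : c ∈ U) :
    ∃ h ∈ polyFunctions (BinaryForms 2 a × BinaryForms 3 b), h c.forms ≠ 0 ∧
      ∀ c' : RationalCurve a b, h c'.forms ≠ 0 → c' ∈ U := by
  obtain ⟨O, hO, rfl⟩ := hU
  change c.forms ∈ O at hc
  suffices ∃ h ∈ polyFunctions (BinaryForms 2 a × BinaryForms 3 b), h c.forms ≠ 0 ∧
      ∀ v, h v ≠ 0 → v ∈ O by
    obtain ⟨h, hh, h1, h2⟩ := this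
    exact ⟨h, hh, h1, fun c' hc' => h2 _ hc'⟩
  generalize c.forms = v at hc
  induction hO with
  | basic s hs =>
    obtain ⟨h, hh, rfl⟩ := hs
    exact ⟨h, hh, hc, fun _ h' => h'⟩
  | univ => exact ⟨_, const_mem_polyFunctions 1, one_ne_zero, fun _ _ => trivial⟩
  | inter s t _ _ hs ht =>
    obtain ⟨h, hh, h1, h2⟩ := hs hc.1
    obtain ⟨k, hk, k1, k2⟩ := ht hc.2
    exact ⟨_, mul_mem_polyFunctions hh hk, mul_ne_zero h1 k1, fun w hw =>
      ⟨h2 w (left_ne_zero_of_mul hw), k2 w (right_ne_zero_of_mul hw)⟩⟩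
  | sUnion S _ ih =>
    obtain ⟨s, hs, hcs⟩ := hc
    obtain ⟨h, hh, h1, h2⟩ := ih s hs hcs
    exact ⟨h, hh, h1, fun w hw => ⟨s, hs, h2 w hw⟩⟩

/-- The curve with given forms. -/
lemma exists_curve {v : BinaryForms 2 5 × BinaryForms 3 2} (h1 : (sylvester v.1).det ≠ 0)
    (h2 : (gram v.2).det ≠ 0) : ∃ c : RationalCurve 5 2, c.forms = v :=
  ⟨⟨v, value_ne_zero_of_sylvester h1, value_ne_zero_of_gram h2⟩, rfl⟩

end generic

end ProjLinePlane

end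
-- The two genericity statements
theorem lemma4p3 :
    (∃ U : Set (ProjLinePlane.RationalCurve 5 2), IsOpen U ∧ U.Nonempty ∧
      ∀ c ∈ U, ∃ M : ProjLinePlane.FormMatrix ProjLinePlane.syzDeg ProjLinePlane.genDeg,
        ProjLinePlane.Resolves M c.carrier) ∧
    (∀ U : Set (ProjLinePlane.RationalCurve 5 2), IsOpen U → U.Nonempty →
      ∃ W : Set (ProjLinePlane.FormMatrix ProjLinePlane.syzDeg ProjLinePlane.genDeg),
        IsOpen[ProjLinePlane.zariski
          (ProjLinePlane.FormMatrix ProjLinePlane.syzDeg ProjLinePlane.genDeg)] W ∧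
        W.Nonempty ∧
        ∀ M ∈ W, ∃ c ∈ U, ProjLinePlane.Resolves M c.carrier) := by
  open ProjLinePlane in
  obtain ⟨v₁, hv₁⟩ := exists_sylvester_det_ne_zero
  obtain ⟨v₂, hv₂⟩ := exists_gram_det_ne_zero
  refine ⟨⟨{c | (gram c.forms.2).det ≠ 0}, ?_, ?_, fun c hc => ?_⟩, fun U hU ⟨c₀, hc₀⟩ => ?_⟩
  · exact ⟨{v | (gram v.2).det ≠ 0}, .basic _ ⟨_, gram_det_mem_polyFunctions, rfl⟩, rfl⟩
  · obtain ⟨v, h1, h2⟩ := exists_ne_zero_and_ne_zero sylvester_det_mem_polyFunctions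
      gram_det_mem_polyFunctions hv₁ hv₂
    obtain ⟨c, rfl⟩ := exists_curve h1 h2
    exact ⟨c, h2⟩
  · obtain ⟨M, hM⟩ := exists_curveForms_eq c.forms.1 c.forms.2 hc
    exact ⟨M, (parametrizes_of_gram c hM.symm hc).resolves⟩
  · obtain ⟨h, hh, h0, hU'⟩ := exists_polyFunction hU hc₀
    have hmul := mul_mem_polyFunctions sylvester_det_mem_polyFunctions gram_det_mem_polyFunctions
    obtain ⟨v, h1, h2⟩ := exists_ne_zero_and_ne_zero sylvester_det_mem_polyFunctions
      gram_det_mem_polyFunctions hv₁ hv₂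
    -- By irreducibility the given open set meets the locus where the resultant and det `gram` are
    -- nonzero; a matrix over such a point shows that the pulled-back open set is nonempty.
    obtain ⟨w, h3, h4⟩ := exists_ne_zero_and_ne_zero hh hmul h0 (mul_ne_zero h1 h2)
    obtain ⟨M₀, hM₀⟩ := exists_curveForms_eq w.1 w.2 (right_ne_zero_of_mul h4)
    refine ⟨{M | h (curveForms M) * ((sylvester (curveForms M).1).det *
      (gram (curveForms M).2).det) ≠ 0}, .basic _ ⟨_, comp_curveForms_mem_polyFunctions
      (mul_mem_polyFunctions hh hmul), rfl⟩, ⟨M₀, ?_⟩, fun M hM => ?_⟩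
    · change h (curveForms M₀) * ((sylvester (curveForms M₀).1).det *
        (gram (curveForms M₀).2).det) ≠ 0
      rw [hM₀]
      exact mul_ne_zero h3 h4
    · have h5 := right_ne_zero_of_mul hM
      -- The resultant and det `gram` being nonzero, the forms attached to `M` have no common zeros
      -- and so define a curve.
      obtain ⟨c, hc⟩ := exists_curve (left_ne_zero_of_mul h5) (right_ne_zero_of_mul h5)
      refine ⟨c, hU' c ?_, (parametrizes_of_gram c hc ?_).resolves⟩
      · rw [hc]
        exact left_ne_zero_of_mul hM
      · rw [hc]
        exact right_ne_zero_of_mul h5
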